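/- Let $n\ge 1$ and let $R$ be the root system of type $B_n$ or $C_n$ in $\mathbb R^n$ (standard basis $e_1,\dots,e_n$, $e_{-a}:=-e_a$) with simple roots $\alpha_1=e_1$ (type $B_n$) or $\alpha_1=2e_1$ (type $C_n$), and $\alpha_i=e_i-e_{i-1}$ for $2\le i\le n$. Let $W$ be its Weyl group, generated by $s_i=s_{\alpha_i}$, with the Bruhat order; write $w=(a_1,\dots,a_n)$ if $w(e_j)=e_{a_j}$ for all $j$. Let $\omega_r$ ($1\le r\le n$) be the fundamental weights, and let $W^{I_r}=\{w\in W: w(\alpha_j)\in R^+ \text{ for all } j\ne r\}$. For a weight $\chi$, write $\chi\ge 0$ if $\chi$ is a nonnegative real combination of simple roots, and $\chi\le 0$ if $-\chi\ge 0$. For integers $p\ge 0$ and $s,t$, let $J_{p,[s,t]}$ be the set of sequences $(i_1,\dots,i_p)$ of integers in $[s,t]$ with $i_{k+1}-i_k\ge 2$ for all $k$. For $\underline i=(i_1,\dots,i_m)$ put $[\underline i]=\{i_1,\dots,i_m\}$, $\underline i'=(i_1-1,\dots,i_m-1)$ and $-\underline i=(-i_m,\dots,-i_1)$. For a set $S$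 of integers, $S\uparrow$ lists its elements in increasing order. Then the set of all minimal elements (in the Bruhat order) of $\{w\in W^{I_r}: w(\omega_r)\le 0\}$ is as follows. (i) If $r=1$, it consists of the single element $w=(-n,-(n-2),\dots,-4,-2,1,3,\dots,n-3,n-1)$ if $n$ is even, and $w=(-n,-(n-2),\dots,-3,-1,2,4,\dots,n-3,n-1)$ if $n$ is odd. (ii) Let $2\le r\le n-1$ and $n+1-r=2m$. For each $\underline i\in J_{m,[2,n]}$ there is a unique $v_{\underline i}\in W^{I_r}$ with $v_{\underline i}(\omega_r)=\sum_{k=1}^m\alpha_{i_k}$, namely $v_{\underline i}=([1,n]\setminus([\underline i]\cup[\underline i'])\uparrow,\,-\underline i',\,\underline i)$. Put $w_{\underline i}=s_{i_1}s_{i_2}\cdots s_{i_m}v_{\underline i}$. Then $w_{\underline i}=([1,n]\setminus([\underline i]\cup[\underline i'])\uparrow,\,-\underline i,\,\underline i')$ and $w_{\underline i}(\omega_r)=-v_{\underline i}(\omega_r)$, and the minimal elements are exactly the $w_{\underline i}$, $\underline i\in J_{m,[2,n]}$. (iii) Let $2\le r\le n-1$ and $n+1-r=2m+1$. For each $\underline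 i\in J_{m,[3,n]}$ there is a unique $v_{\underline i}\in W^{I_r}$ with $v_{\underline i}(\omega_r)=c\,\alpha_1+\sum_{k=1}^m\alpha_{i_k}$, where $c=1$ in type $B_n$ and $c=\tfrac12$ in type $C_n$, namely $v_{\underline i}=([1,n]\setminus(\{1\}\cup[\underline i]\cup[\underline i'])\uparrow,\,-\underline i',\,1,\,\underline i)$. Put $w_{\underline i}=s_1s_{i_1}s_{i_2}\cdots s_{i_m}v_{\underline i}$. Then $w_{\underline i}=([1,n]\setminus(\{1\}\cup[\underline i]\cup[\underline i'])\uparrow,\,-\underline i,\,-1,\,\underline i')$ and $w_{\underline i}(\omega_r)=-v_{\underline i}(\omega_r)$, and the minimal elements are exactly the $w_{\underline i}$, $\underline i\in J_{m,[3,n]}$. (iv) If $r=n$, it consists of the single element $w=(2,3,\dots,n-1,n,-1)$. -/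

import Mathlib

/-- The two families of root systems: `B` for type `B_n`, `C` for type `C_n`. -/
inductive BCType : Type
  | B
  | C

namespace BCType

noncomputable section

/-- The Euclidean space spanned by the weights; its standard basis is `e 1, …, e n`. -/
abbrev V (n : ℕ) : Type := EuclideanSpace ℝ (Fin n)

/-- The vector `e a` for an integer `a`: the `a`-th standard basis vector for `1 ≤ a ≤ n`, with
`e (-a) = -e a` (and `e a = 0` for all the other values of `a`). -/
def e (n : ℕ) (a : ℤ) : V n :=
  WithLp.toLp 2 (fun k : Fin n =>
    if a = (k : ℤ) + 1 then (1 : ℝ) else if a = -((k : ℤ) + 1) then -1 else 0)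

/-- The length of the special simple root: `e 1` is a root in type `B_n`, `2 e 1` in type `C_n`. -/
def specialLength : BCType → ℝ
  | B => 1
  | C => 2

/-- The simple roots `α_1, …, α_n`, where `α_1` is the special node of the Dynkin diagram:
`α_1 = e 1` (type `B_n`) or `2 e 1` (type `C_n`), and `α_i = e i - e (i - 1)` for `2 ≤ i ≤ n`. -/
def simpleRoot (t : BCType) (n : ℕ) (i : ℤ) : V n :=
  if i = 1 then t.specialLength • e n 1 else e n i - e n (i - 1)

/-- The set `R` of all roots: `±e a` (type `B_n`) or `±2 e a` (type `C_n`), together with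
`±e a ± e b` for `a ≠ b`. -/
def roots (t : BCType) (n : ℕ) : Set (V n) :=
  {x | ∃ a : ℤ, 1 ≤ |a| ∧ |a| ≤ n ∧ x = t.specialLength • e n a} ∪
  {x | ∃ a b : ℤ, 1 ≤ |a| ∧ |a| ≤ n ∧ 1 ≤ |b| ∧ |b| ≤ n ∧ |a| ≠ |b| ∧ x = e n a + e n b}

/-- `x ≥ 0` in the dominance order: `x` is a nonnegative real combination of simple roots. -/
def IsNonneg (t : BCType) (n : ℕ) (x : V n) : Prop :=
  ∃ c : ℤ → ℝ, (∀ j ∈ Finset.Icc (1 : ℤ) n, 0 ≤ c j) ∧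
    x = ∑ j ∈ Finset.Icc (1 : ℤ) n, c j • simpleRoot t n j

/-- `x ≤ 0` in the dominance order. -/
def IsNonpos (t : BCType) (n : ℕ) (x : V n) : Prop := IsNonneg t n (-x)

/-- The set `R⁺` of positive roots. -/
def posRoots (t : BCType) (n : ℕ) : Set (V n) := {x | x ∈ roots t n ∧ IsNonneg t n x}

/-- `ω` is the fundamental weight `ω_r`: `⟨ω, α_j^∨⟩ = δ_{jr}`, where
`⟨χ, α^∨⟩ = 2 (χ, α) / (α, α)`. -/
def IsFundamentalWeight (t : BCType) (n : ℕ) (r : ℤ) (ω : V n) : Prop :=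
  ∀ j ∈ Finset.Icc (1 : ℤ) n,
    2 * inner ℝ ω (simpleRoot t n j) / inner ℝ (simpleRoot t n j) (simpleRoot t n j) =
      if j = r then 1 else 0

/-- The reflection `s_β` in the hyperplane orthogonal to `β`. -/
def refl (n : ℕ) (β : V n) : V n ≃ₗᵢ[ℝ] V n := (ℝ ∙ β)ᗮ.reflection

/-- The simple reflection `s_i`. -/
def s (t : BCType) (n : ℕ) (i : ℤ) : V n ≃ₗᵢ[ℝ] V n := refl n (simpleRoot t n i)

/-- The Weyl group `W`, generated by the simple reflections `s_1, …, s_n`. -/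
def weylGroup (t : BCType) (n : ℕ) : Subgroup (V n ≃ₗᵢ[ℝ] V n) :=
  Subgroup.closure (s t n '' Set.Icc (1 : ℤ) n)

/-- The product `s_{i_1} s_{i_2} ⋯ s_{i_m}` for a sequence `(i_1, …, i_m)`. -/
def wordProd (t : BCType) (n : ℕ) (l : List ℤ) : V n ≃ₗᵢ[ℝ] V n := (l.map (s t n)).prod

/-- The length of `w ∈ W`: the least length of a word in the simple reflections with product `w`. -/
def length (t : BCType) (n : ℕ) (w : V n ≃ₗᵢ[ℝ] V n) : ℕ :=
  sInf {k | ∃ l : List ℤ, (∀ i ∈ l, i ∈ Set.Icc (1 : ℤ) n) ∧ l.length = k ∧ wordProd t n l = w}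

/-- The Bruhat order on `W`: `u ≤ w` if `w` is reached from `u` by successive multiplications by
reflections `s_β`, `β` a root, each of which increases the length. -/
def BruhatLE (t : BCType) (n : ℕ) (u w : V n ≃ₗᵢ[ℝ] V n) : Prop :=
  Relation.ReflTransGen
    (fun x y => ∃ β ∈ roots t n, y = refl n β * x ∧ length t n x < length t n y) u w

/-- The set `W^I` of minimal coset representatives, for a set `I` of (indices of) simple roots:
the `w ∈ W` such that `w(α_j)` is a positive root for every simple root `α_j` not in `I`. -/
def minReps (t : BCType) (n : ℕ) (I : Set ℤ) : Set (V n ≃ₗᵢ[ℝ] V n) :=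
  {w | w ∈ weylGroup t n ∧ ∀ j ∈ Set.Icc (1 : ℤ) n, j ∉ I → w (simpleRoot t n j) ∈ posRoots t n}

/-- The set of all minimal elements, for the Bruhat order, of `{w ∈ W^I : w(ω) ≤ 0}`. -/
def minimalNonpos (t : BCType) (n : ℕ) (I : Set ℤ) (ω : V n) : Set (V n ≃ₗᵢ[ℝ] V n) :=
  {w | (w ∈ minReps t n I ∧ IsNonpos t n (w ω)) ∧
    ∀ u ∈ minReps t n I, IsNonpos t n (u ω) → BruhatLE t n u w → u = w}

/-- `w` is the signed permutation written `(a_1, …, a_n)` in one-line notation, that is,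
`w(e j) = e (a_j)` for `j = 1, …, n`. -/
def HasOneLine (n : ℕ) (w : V n ≃ₗᵢ[ℝ] V n) (a : List ℤ) : Prop :=
  (∀ x ∈ a, 1 ≤ |x| ∧ |x| ≤ n) ∧
    List.ofFn (fun j : Fin n => w (e n ((j : ℤ) + 1))) = a.map (e n)

/-- The set `J_{p,[a,b]}` of sequences `(i_1, …, i_p)` of elements of `[a, b]` with
`i_{k+1} - i_k ≥ 2` for all `k`. -/
def J (p : ℕ) (a b : ℤ) : Set (List ℤ) :=
  {i | i.length = p ∧ (∀ x ∈ i, a ≤ x ∧ x ≤ b) ∧ i.IsChain (fun x y => 2 ≤ y - x)}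

/-- `-i = (-i_m, …, -i_1)` for a sequence `i = (i_1, …, i_m)`. -/
def negSeq (i : List ℤ) : List ℤ := (i.map (fun x => -x)).reverse

/-- `i' = (i_1 - 1, …, i_m - 1)` for a sequence `i = (i_1, …, i_m)`. -/
def predSeq (i : List ℤ) : List ℤ := i.map (fun x => x - 1)

/-- `([1, n] \ S) ↑`: the elements of `[1, n]` outside `S`, in increasing order. -/
def complUp (n : ℕ) (S : Finset ℤ) : List ℤ := (Finset.Icc (1 : ℤ) n \ S).sort (· ≤ ·)

end

end BCType

/-! The Weyl group acts on the vectors `e a` through the odd permutations `σ` of `ℤ` that fix every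
`a` with `|a| > n`, and `ω_r` is a positive multiple of `e r + ⋯ + e n`. An element of `W^{I_r}` is
determined by its weight `f = wt n r σ`, an odd function with values in `{-1, 0, 1}` and `n + 1 - r`
ones on `[-n, n]`; every such function occurs (`IsMin.eq_of_wt_eq`, `exists_isMin`), and the length
is the number of inversions of `f` (`IsMin.inversions_eq`). The condition `w(ω_r) ≤ 0` says that
every tail sum `f i + ⋯ + f n`, `1 ≤ i ≤ n`, is nonpositive.

If `f i < f (i - 1)`, then `s_i w` is again in `W^{I_r}`, is shorter by one and lies below `w`; only
the tail sum at `i` changes. A function from which no such step keeps the tail sums nonpositive is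
minus a sum of blocks `e i - e (i - 1)`, where `e 0 = 0` and the indices differ by at least 2
(`exists_blkSum_of_stuck`). So every element of the set lies above a block element.

All block elements have the same length, so none is strictly below another. Indeed, for `f` minus a
sum of `m` blocks, the inversions of `f` and of `-f` add up to the number of pairs with distinct
values, which is invariant under `W`, and they differ by `m`, because turning over one block creates
one inversion. Counting ones gives `2m = n + 1 - r`, plus 1 if there is a block at 1; parity then
determines both `m` and whether 1 occurs. Hence the minimal elements are exactly the block elements
(`mem_minimalNonpos_iff`), and the four cases amount to listing the possible blocks. -/

namespace SignedPerm

open Finset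

noncomputable section

/-! ### Signed permutations and simple reflections. -/

/-- The simple reflection `s_i` acting on the indices of `e a`, `a : ℤ`. -/
def sg (i a : ℤ) : ℤ :=
  if i ≤ 0 then a
  else if i = 1 then (if a = 1 then -1 else if a = -1 then 1 else a)
  else if a = i then i - 1
  else if a = i - 1 then i
  else if a = -i then -(i - 1)
  else if a = -(i - 1) then -i
  else a

lemma sg_sg (i a : ℤ) : sg i (sg i a) = a := by
  grind (splits := 20) [sg]

lemma sg_neg (i a : ℤ) : sg i (-a) = -sg i a := by
  unfold sg; split_ifs <;> omega

lemma sg_of_large {i a n : ℤ} (hi : i ≤ n) (ha : n < |a|) : sg i a = a := by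
  rcases lt_abs.1 ha with h | h <;> (unfold sg; split_ifs <;> omega)

lemma sg_self {i : ℤ} (hi : 2 ≤ i) : sg i i = i - 1 := by
  unfold sg; split_ifs <;> omega

lemma sg_pred {i : ℤ} (hi : 2 ≤ i) : sg i (i - 1) = i := by
  unfold sg; split_ifs <;> omega

lemma sg_one_one : sg 1 1 = -1 := rfl

lemma sg_zero (i : ℤ) : sg i 0 = 0 := by
  grind [sg]

/-- The first two exceptions are the two ways of writing `α_i`; the third is needed only for `s_1`
at `(-1, 1)`. -/
lemma sg_lt {i a b : ℤ} (h : a < b) (h1 : ¬(a = i - 1 ∧ b = i))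
    (h2 : ¬(a = -i ∧ b = -(i - 1))) (h3 : b ≠ -a) : sg i a < sg i b := by
  unfold sg; split_ifs <;> omega

/-- The simple reflection `s_i` as a permutation of `ℤ`. -/
def sgPerm (i : ℤ) : Equiv.Perm ℤ := Function.Involutive.toPerm (sg i) (sg_sg i)

@[simp] lemma sgPerm_apply (i a : ℤ) : sgPerm i a = sg i a := rfl

lemma sgPerm_mul_self (i : ℤ) : sgPerm i * sgPerm i = 1 := by
  ext a; simp [sg_sg]

lemma sgPerm_inv (i : ℤ) : (sgPerm i)⁻¹ = sgPerm i :=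
  inv_eq_of_mul_eq_one_left (sgPerm_mul_self i)

/-- The signed permutations of `[-n, n]`, extended by the identity to `ℤ`. -/
def signedPerms (n : ℕ) : Subgroup (Equiv.Perm ℤ) where
  carrier := {σ | (∀ a, σ (-a) = -σ a) ∧ ∀ a, (n : ℤ) < |a| → σ a = a}
  one_mem' := ⟨fun _ => rfl, fun _ _ => rfl⟩
  mul_mem' := by
    rintro σ τ ⟨h1, h2⟩ ⟨h3, h4⟩
    refine ⟨fun a => ?_, fun a ha => ?_⟩
    · simp [h1, h3]
    · simp [h4 a ha, h2 a ha]
  inv_mem' := by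
    rintro σ ⟨h1, h2⟩
    refine ⟨fun a => ?_, fun a ha => ?_⟩
    · rw [Equiv.Perm.inv_eq_iff_eq, h1]; simp
    · rw [Equiv.Perm.inv_eq_iff_eq, h2 a ha]

lemma sgPerm_mem {n : ℕ} {i : ℤ} (hi : i ≤ n) : sgPerm i ∈ signedPerms n :=
  ⟨sg_neg i, fun _ ha => sg_of_large hi ha⟩

lemma map_zero_of_mem {n : ℕ} {σ : Equiv.Perm ℤ} (hσ : σ ∈ signedPerms n) : σ 0 = 0 := by
  have := hσ.1 0
  rw [neg_zero] at this
  omega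

lemma abs_map_le {n : ℕ} {σ : Equiv.Perm ℤ} (hσ : σ ∈ signedPerms n) {a : ℤ} (ha : |a| ≤ n) :
    |σ a| ≤ n := by
  by_contra h
  have h1 := hσ.2 (σ a) (not_le.1 h)
  rw [σ.injective h1] at h
  exact h ha

lemma map_ne_zero {n : ℕ} {σ : Equiv.Perm ℤ} (hσ : σ ∈ signedPerms n) {a : ℤ} (ha : a ≠ 0) :
    σ a ≠ 0 := by
  intro h
  exact ha (σ.injective (h.trans (map_zero_of_mem hσ).symm))

/-- The values at `0, …, n` climb strictly from `0` and never exceed `n`, which leaves no room for a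
gap. -/
lemma eq_one_of_increasing {n : ℕ} {σ : Equiv.Perm ℤ} (hσ : σ ∈ signedPerms n)
    (h : ∀ i : ℤ, 1 ≤ i → i ≤ n → σ (i - 1) < σ i) : σ = 1 := by
  have h1 : ∀ k : ℕ, k ≤ n → (k : ℤ) ≤ σ k := by
    intro k
    induction k with
    | zero => intro _; simp [map_zero_of_mem hσ]
    | succ k ih =>
      intro hk
      have := ih (by omega)
      have h2 := h ((k + 1 : ℕ) : ℤ) (by omega) (by omega)
      rw [show (((k + 1 : ℕ) : ℤ) - 1) = k by push_cast; ring] at h2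
      push_cast at *
      omega
  have h2 : ∀ k : ℕ, k ≤ n → σ ((n : ℤ) - k) ≤ n - k := by
    intro k
    induction k with
    | zero =>
      intro _
      simpa using (abs_le.1 (abs_map_le hσ (a := n) (by simp))).2
    | succ k ih =>
      intro hk
      have := ih (by omega)
      have h2 := h ((n : ℤ) - k) (by omega) (by omega)
      rw [show ((n : ℤ) - k - 1) = n - (k + 1 : ℕ) by push_cast; ring] at h2
      push_cast at *
      omega
  have h3 : ∀ k : ℕ, k ≤ n → σ k = k := by
    intro k hk
    refine le_antisymm ?_ (h1 k hk)
    have := h2 (n - k) (by omega)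
    rwa [show ((n : ℤ) - ((n - k : ℕ) : ℤ)) = k by omega] at this
  ext a
  rw [Equiv.Perm.one_apply]
  by_cases ha : (n : ℤ) < |a|
  · exact hσ.2 a ha
  · rcases le_total 0 a with h0 | h0
    · lift a to ℕ using h0
      exact h3 a (by simpa using ha)
    · obtain ⟨b, rfl⟩ : ∃ b : ℕ, a = -(b : ℤ) := ⟨(-a).toNat, by omega⟩
      rw [hσ.1, h3 b (by simpa using ha)]

/-! ### Inversions, and how a simple reflection changes their number. -/

/-- The pairs of indices representing the positive roots. -/
def pairs (n : ℕ) : Finset (ℤ × ℤ) :=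
  (Icc (-n : ℤ) n ×ˢ Icc (1 : ℤ) n).filter fun p => -p.2 < p.1 ∧ p.1 < p.2

lemma mem_pairs {n : ℕ} {p : ℤ × ℤ} : p ∈ pairs n ↔ -p.2 < p.1 ∧ p.1 < p.2 ∧ p.2 ≤ n := by
  simp only [pairs, mem_filter, mem_product, mem_Icc]
  omega

/-- The number of pairs whose values under `f` are in the relation `R`. -/
def cnt (n : ℕ) (R : ℤ → ℤ → Prop) [DecidableRel R] (f : ℤ → ℤ) : ℕ :=
  ((pairs n).filter fun p => R (f p.1) (f p.2)).card

/-- The action of `s_i` on the pairs other than `(i - 1, i)`. -/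
def pairMap (i : ℤ) (p : ℤ × ℤ) : ℤ × ℤ :=
  if p = (-(i - 1), i) then p else (sg i p.1, sg i p.2)

/-- The pair `(a, b)` stands for the root `e b - e a`, and `|a| < b` selects one of `(a, b)`, `(-b,
-a)`. A simple reflection permutes the positive roots other than its own. It fixes `e i + e (i -
1)`, but applying `sg i` to both entries of that pair would give the wrong representative `(-i, i -
1)`; hence the exceptional case in `pairMap`. -/
lemma pairMap_mem {n : ℕ} {i : ℤ} (h1 : 1 ≤ i) (hn : i ≤ n) {p : ℤ × ℤ}
    (hp : p ∈ (pairs n).erase (i - 1, i)) : pairMap i p ∈ (pairs n).erase (i - 1, i) := by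
  obtain ⟨a, b⟩ := p
  simp only [mem_erase, mem_pairs, ne_eq, Prod.mk.injEq, pairMap] at *
  split_ifs with h
  · simp only [Prod.mk.injEq]; omega
  · simp only [Prod.mk.injEq]
    unfold sg
    split_ifs <;> omega

lemma pairMap_pairMap {n : ℕ} {i : ℤ} {p : ℤ × ℤ}
    (hp : p ∈ (pairs n).erase (i - 1, i)) : pairMap i (pairMap i p) = p := by
  obtain ⟨a, b⟩ := p
  simp only [mem_erase, mem_pairs, ne_eq, Prod.mk.injEq] at hp
  by_cases h : (a, b) = (-(i - 1), i)
  · rw [pairMap, pairMap, if_pos h, if_pos h]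
  · have h2 : (sg i a, sg i b) ≠ (-(i - 1), i) := by
      simp only [ne_eq, Prod.mk.injEq] at h ⊢
      unfold sg
      split_ifs <;> omega
    rw [show pairMap i (a, b) = (sg i a, sg i b) from if_neg h, pairMap, if_neg h2]
    simp [sg_sg]

/-- For odd `f`, the symmetry `hR` makes the relation depend only on the root and not on the pair
chosen to represent it. -/
lemma rel_pairMap {R : ℤ → ℤ → Prop} (hR : ∀ a b, R a b → R (-b) (-a)) {f : ℤ → ℤ} (hf : f.Odd) {i : ℤ} (hi : 1 ≤ i)
    {p : ℤ × ℤ} (hp : p ≠ (i - 1, i)) (h : R (f p.1) (f p.2)) :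
    R (f (sg i (pairMap i p).1)) (f (sg i (pairMap i p).2)) := by
  obtain ⟨a, b⟩ := p
  unfold pairMap
  split_ifs with h1
  · simp only [Prod.mk.injEq] at h1 hp
    obtain ⟨rfl, rfl⟩ := h1
    have h2 : 2 ≤ b := by
      rcases eq_or_ne b 1 with rfl | h3
      · simp at hp
      · omega
    have h4 := hR _ _ h
    rw [← hf, ← hf, neg_neg] at h4
    simpa only [sg_neg, sg_self h2, sg_pred h2] using h4
  · simpa [sg_sg] using h

lemma card_erase_comp_sg {R : ℤ → ℤ → Prop} [DecidableRel R]
    (hR : ∀ a b, R a b → R (-b) (-a)) {n : ℕ} {f : ℤ → ℤ} (hf : f.Odd)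
    {i : ℤ} (h1 : 1 ≤ i) (hn : i ≤ n) :
    (((pairs n).erase (i - 1, i)).filter fun p => R (f (sg i p.1)) (f (sg i p.2))).card =
      (((pairs n).erase (i - 1, i)).filter fun p => R (f p.1) (f p.2)).card := by
  refine card_nbij' (pairMap i) (pairMap i) ?_ ?_ ?_ ?_
  · intro p hp
    rw [coe_filter, Set.mem_ofPred_eq] at hp ⊢
    refine ⟨pairMap_mem h1 hn hp.1, ?_⟩
    have hg : (f ∘ sg i).Odd := fun a => by simp [sg_neg, hf (sg i a)]
    have := rel_pairMap hR hg h1 (mem_erase.1 hp.1).1 hp.2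
    simpa [sg_sg] using this
  · intro p hp
    rw [coe_filter, Set.mem_ofPred_eq] at hp ⊢
    exact ⟨pairMap_mem h1 hn hp.1, rel_pairMap hR hf h1 (mem_erase.1 hp.1).1 hp.2⟩
  · intro p hp
    rw [coe_filter, Set.mem_ofPred_eq] at hp
    exact pairMap_pairMap hp.1
  · intro p hp
    rw [coe_filter, Set.mem_ofPred_eq] at hp
    exact pairMap_pairMap hp.1

lemma card_filter_erase_add {α : Type*} [DecidableEq α] (s : Finset α) (p : α → Prop)
    [DecidablePred p] {a : α} (ha : a ∈ s) :
    ((s.erase a).filter p).card + (if p a then 1 else 0) = (s.filter p).card := by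
  conv_rhs => rw [← insert_erase ha, filter_insert]
  split_ifs with h
  · rw [card_insert_of_notMem (by simp)]
  · simp

/-- All pairs except `(i - 1, i)` are merely permuted, so only this pair can change the count. -/
lemma cnt_comp_sg {R : ℤ → ℤ → Prop} [DecidableRel R]
    (hR : ∀ a b, R a b → R (-b) (-a)) {n : ℕ} {f : ℤ → ℤ} (hf : f.Odd)
    {i : ℤ} (h1 : 1 ≤ i) (hn : i ≤ n) :
    cnt n R (f ∘ sg i) + (if R (f (i - 1)) (f i) then 1 else 0) =
      cnt n R f + (if R (f i) (f (i - 1)) then 1 else 0) := by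
  have hmem : (i - 1, i) ∈ pairs n := by rw [mem_pairs]; simp only; omega
  have e1 := card_filter_erase_add (pairs n) (fun p => R (f p.1) (f p.2)) hmem
  have e2 := card_filter_erase_add (pairs n) (fun p => R (f (sg i p.1)) (f (sg i p.2))) hmem
  rw [card_erase_comp_sg hR hf h1 hn] at e2
  have e3 : R (f (sg i (i - 1))) (f (sg i i)) ↔ R (f i) (f (i - 1)) := by
    rcases eq_or_lt_of_le h1 with rfl | h2
    · have h0 : f 0 = 0 := hf.map_zero
      simp only [sub_self, sg_zero, sg_one_one, hf 1, h0]
      exact ⟨fun h => by simpa using hR _ _ h, fun h => by simpa using hR _ _ h⟩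
    · rw [sg_self (by omega), sg_pred (by omega)]
  simp only at e1
  simp only [e3] at e2
  simp only [cnt, Function.comp_apply]
  omega

/-- The number of inversions of an odd function on `[-n, n]`. -/
def inversions (n : ℕ) (f : ℤ → ℤ) : ℕ := cnt n (fun a b => b < a) f

/-- The number of pairs of indices at which `f` takes distinct values. -/
def distinct (n : ℕ) (f : ℤ → ℤ) : ℕ := cnt n (fun a b => a ≠ b) f

lemma inversions_comp_sg {n : ℕ} {f : ℤ → ℤ} (hf : f.Odd) {i : ℤ} (h1 : 1 ≤ i) (hn : i ≤ n)
    (h : f (i - 1) < f i) : inversions n (f ∘ sg i) = inversions n f + 1 := by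
  have := cnt_comp_sg (R := fun a b => b < a) (by intros; omega) hf h1 hn
  rwa [if_neg (by omega), if_pos h] at this

lemma inversions_comp_sg_of_gt {n : ℕ} {f : ℤ → ℤ} (hf : f.Odd) {i : ℤ} (h1 : 1 ≤ i) (hn : i ≤ n)
    (h : f i < f (i - 1)) : inversions n (f ∘ sg i) + 1 = inversions n f := by
  have := cnt_comp_sg (R := fun a b => b < a) (by intros; omega) hf h1 hn
  rwa [if_neg (c := f (i - 1) < f i) (by omega), if_pos h] at this

lemma inversions_comp_sg_le {n : ℕ} {f : ℤ → ℤ} (hf : f.Odd) {i : ℤ} (h1 : 1 ≤ i) (hn : i ≤ n) :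
    inversions n (f ∘ sg i) ≤ inversions n f + 1 := by
  have := cnt_comp_sg (R := fun a b => b < a) (by intros; omega) hf h1 hn
  simp only [inversions]
  split_ifs at this <;> omega

lemma distinct_comp_sg {n : ℕ} {f : ℤ → ℤ} (hf : f.Odd) {i : ℤ} (h1 : 1 ≤ i) (hn : i ≤ n) :
    distinct n (f ∘ sg i) = distinct n f := by
  have := cnt_comp_sg (R := fun a b => a ≠ b) (by intros; omega) hf h1 hn
  simp only [distinct]
  split_ifs at this <;> omega

lemma odd_comp {f g : ℤ → ℤ} (hf : f.Odd) (hg : g.Odd) : (f ∘ g).Odd := fun a => by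
  simp only [Function.comp_apply, hg a, hf (g a)]

lemma sg_odd (i : ℤ) : (sg i).Odd := sg_neg i

/-- Two distinct values are out of order for exactly one of `f` and `-f`. -/
lemma inversions_add_inversions_neg (n : ℕ) (f : ℤ → ℤ) : inversions n f + inversions n (-f) = distinct n f := by
  simp only [inversions, distinct, cnt]
  rw [← card_union_of_disjoint, ← filter_or]
  · congr 1
    refine filter_congr fun p _ => ?_
    simp only [Pi.neg_apply]
    omega
  · rw [disjoint_filter]
    intro p _
    simp only [Pi.neg_apply]
    omega

/-! ### Words in the simple reflections: the length is the number of inversions. -/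

/-- The product of the simple reflections in a word, as a permutation of `ℤ`. -/
def wordPerm (l : List ℤ) : Equiv.Perm ℤ := (l.map sgPerm).prod

lemma wordPerm_mem {n : ℕ} {l : List ℤ} (hl : ∀ i ∈ l, i ≤ (n : ℤ)) :
    wordPerm l ∈ signedPerms n := by
  refine Subgroup.list_prod_mem _ fun σ hσ => ?_
  obtain ⟨i, hi, rfl⟩ := List.mem_map.1 hσ
  exact sgPerm_mem (hl i hi)

lemma wordPerm_append (l l' : List ℤ) : wordPerm (l ++ l') = wordPerm l * wordPerm l' := by
  simp [wordPerm]

lemma wordPerm_reverse (l : List ℤ) : wordPerm l.reverse = (wordPerm l)⁻¹ := by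
  induction l with
  | nil => rfl
  | cons i l ih =>
    rw [List.reverse_cons, wordPerm_append, ih]
    simp [wordPerm, sgPerm_inv]

lemma inversions_one (n : ℕ) : inversions n (1 : Equiv.Perm ℤ) = 0 := by
  refine card_eq_zero.2 (filter_eq_empty_iff.2 fun p hp => ?_)
  rw [mem_pairs] at hp
  simp only [Equiv.Perm.one_apply]
  omega

/-- Bubble sort: a permutation other than the identity has a descent, and right multiplication by
that simple reflection removes one inversion. -/
lemma exists_wordPerm_eq {n : ℕ} {σ : Equiv.Perm ℤ} (hσ : σ ∈ signedPerms n) :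
    ∃ l : List ℤ, (∀ i ∈ l, 1 ≤ i ∧ i ≤ (n : ℤ)) ∧ l.length = inversions n σ ∧ wordPerm l = σ := by
  induction hk : inversions n σ generalizing σ with
  | zero =>
    refine ⟨[], by simp, rfl, ?_⟩
    refine (eq_one_of_increasing hσ fun i h1 hn => ?_).symm
    by_contra h
    have hne : σ (i - 1) ≠ σ i := fun h => by have := σ.injective h; omega
    have := inversions_comp_sg_of_gt (n := n) hσ.1 h1 hn (by omega)
    omega
  | succ k ih =>
    obtain ⟨i, h1, hn, h⟩ : ∃ i : ℤ, 1 ≤ i ∧ i ≤ n ∧ σ i < σ (i - 1) := by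
      by_contra! h
      have : σ = 1 := eq_one_of_increasing hσ fun i h1 hn =>
        lt_of_le_of_ne (h i h1 hn) fun h => by have := σ.injective h; omega
      rw [this, inversions_one] at hk
      omega
    have h2 : inversions n (σ * sgPerm i : Equiv.Perm ℤ) + 1 = inversions n σ :=
      inversions_comp_sg_of_gt hσ.1 h1 hn h
    obtain ⟨l, hl, hlen, hw⟩ := ih (mul_mem hσ (sgPerm_mem hn)) (by omega)
    refine ⟨l ++ [i], ?_, by simp [hlen], ?_⟩
    · simp only [List.mem_append, List.mem_singleton]
      rintro j (hj | rfl)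
      exacts [hl j hj, ⟨h1, hn⟩]
    · rw [wordPerm_append, hw]
      simp [wordPerm, mul_assoc, sgPerm_mul_self]

lemma inversions_wordPerm_le {n : ℕ} {l : List ℤ} (hl : ∀ i ∈ l, 1 ≤ i ∧ i ≤ (n : ℤ)) :
    inversions n (wordPerm l) ≤ l.length := by
  induction l using List.reverseRecOn with
  | nil => exact (inversions_one n).le
  | append_singleton l i ih =>
    have h1 := ih fun j hj => hl j (by simp [hj])
    have hi := hl i (by simp)
    have h2 : inversions n (wordPerm (l ++ [i])) ≤ inversions n (wordPerm l) + 1 := by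
      rw [wordPerm_append, show wordPerm [i] = sgPerm i by simp [wordPerm]]
      exact inversions_comp_sg_le
        (wordPerm_mem (n := n) fun j hj => (hl j (by simp [hj])).2).1 hi.1 hi.2
    rw [List.length_append, List.length_singleton]
    omega

lemma inversions_inv_le {n : ℕ} {σ : Equiv.Perm ℤ} (hσ : σ ∈ signedPerms n) :
    inversions n (σ⁻¹ : Equiv.Perm ℤ) ≤ inversions n σ := by
  obtain ⟨l, hl, hlen, hw⟩ := exists_wordPerm_eq hσ
  rw [← hlen, ← hw, ← wordPerm_reverse, ← List.length_reverse]
  exact inversions_wordPerm_le (by simpa using hl)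

lemma inversions_inv {n : ℕ} {σ : Equiv.Perm ℤ} (hσ : σ ∈ signedPerms n) :
    inversions n (σ⁻¹ : Equiv.Perm ℤ) = inversions n σ :=
  le_antisymm (inversions_inv_le hσ) (by simpa using inversions_inv_le (inv_mem hσ))

/-- Unlike `inversions`, this count is invariant under the whole group; it serves as the fixed total
in the length computation. -/
lemma distinct_comp {n : ℕ} {σ : Equiv.Perm ℤ} (hσ : σ ∈ signedPerms n) {f : ℤ → ℤ}
    (hf : f.Odd) : distinct n (f ∘ σ) = distinct n f := by
  obtain ⟨l, hl, -, rfl⟩ := exists_wordPerm_eq hσ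
  clear hσ
  induction l using List.reverseRecOn with
  | nil => rfl
  | append_singleton l i ih =>
    have hi := hl i (by simp)
    have hl' : ∀ j ∈ l, 1 ≤ j ∧ j ≤ (n : ℤ) := fun j hj => hl j (by simp [hj])
    rw [← ih hl', ← distinct_comp_sg (odd_comp hf (wordPerm_mem fun j hj => (hl' j hj).2).1)
      hi.1 hi.2, wordPerm_append]
    simp [wordPerm, Function.comp_assoc]
    rfl

end

end SignedPerm

namespace SignedPerm

open Finset

noncomputable section

/-! ### Minimal coset representatives and their weights. -/

/-- The coordinates of the vector `e r + ⋯ + e n`, as an odd function of the index. -/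
def theta (n r : ℕ) (a : ℤ) : ℤ :=
  if r ≤ a ∧ a ≤ n then 1 else if r ≤ -a ∧ -a ≤ n then -1 else 0

lemma theta_odd {n r : ℕ} (hr : 1 ≤ r) : (theta n r).Odd := fun a => by
  unfold theta; split_ifs <;> omega

/-- The signed permutations which are minimal in their coset of the stabilizer of `theta n r`. -/
def IsMin (n r : ℕ) (σ : Equiv.Perm ℤ) : Prop :=
  σ ∈ signedPerms n ∧ ∀ j : ℤ, 1 ≤ j → j ≤ n → j ≠ r → σ (j - 1) < σ j

/-- The coordinates of the image of `e r + ⋯ + e n` under `σ`. -/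
def wt (n r : ℕ) (σ : Equiv.Perm ℤ) (a : ℤ) : ℤ := theta n r (σ⁻¹ a)

lemma wt_apply (n r : ℕ) (σ : Equiv.Perm ℤ) (a : ℤ) : wt n r σ (σ a) = theta n r a := by
  simp [wt]

lemma wt_odd {n r : ℕ} (hr : 1 ≤ r) {σ : Equiv.Perm ℤ} (hσ : σ ∈ signedPerms n) :
    (wt n r σ).Odd :=
  odd_comp (theta_odd hr) (inv_mem hσ).1

lemma wt_sgPerm_mul (n r : ℕ) (i : ℤ) (σ : Equiv.Perm ℤ) :
    wt n r (sgPerm i * σ) = wt n r σ ∘ sg i := by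
  ext a
  simp only [wt, mul_inv_rev, sgPerm_inv, Equiv.Perm.mul_apply, sgPerm_apply, Function.comp_apply]

lemma wt_range (n r : ℕ) (σ : Equiv.Perm ℤ) (a : ℤ) :
    wt n r σ a = -1 ∨ wt n r σ a = 0 ∨ wt n r σ a = 1 := by
  unfold wt theta; split_ifs <;> omega

lemma wt_of_large {n r : ℕ} {σ : Equiv.Perm ℤ} (hσ : σ ∈ signedPerms n) {a : ℤ}
    (ha : (n : ℤ) < |a|) : wt n r σ a = 0 := by
  rw [wt, (inv_mem hσ).2 a ha]
  unfold theta
  rcases lt_abs.1 ha with h | h <;> (split_ifs <;> omega)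

lemma theta_eq_one {n r : ℕ} {a : ℤ} : theta n r a = 1 ↔ r ≤ a ∧ a ≤ n := by
  unfold theta
  split_ifs with h1 h2
  · simp [h1]
  · simp [h1]
  · simp [h1]

lemma theta_mono {n r : ℕ} (hr : 1 ≤ r) {a b : ℤ} (h : a ≤ b) (ha : -n ≤ a) (hb : b ≤ n) :
    theta n r a ≤ theta n r b := by
  unfold theta; split_ifs <;> omega

lemma theta_pred_eq {n r : ℕ} (hr : 1 ≤ r) {j : ℤ} (h1 : 1 ≤ j) (hn : j ≤ n) (hj : j ≠ r) :
    theta n r (j - 1) = theta n r j := by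
  unfold theta; split_ifs <;> omega

/-- An ascent of `σ` at `j ≠ r` could be destroyed only if `σ (j - 1)` and `σ j` were `i - 1` and
`i`, or their negatives in reverse order. Since `theta` does not jump at `j`, the weight would then
agree at `i - 1` and `i`. -/
lemma IsMin.sgPerm_mul {n r : ℕ} (hr : 1 ≤ r) {σ : Equiv.Perm ℤ} (hσ : IsMin n r σ) {i : ℤ}
    (hn : i ≤ n) (h : wt n r σ (i - 1) ≠ wt n r σ i) :
    IsMin n r (sgPerm i * σ) := by
  refine ⟨mul_mem (sgPerm_mem hn) hσ.1, fun j hj1 hjn hjr => ?_⟩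
  have ht := theta_pred_eq hr hj1 hjn hjr
  rw [← wt_apply n r σ, ← wt_apply n r σ] at ht
  have hodd := wt_odd hr hσ.1
  refine sg_lt (hσ.2 j hj1 hjn hjr) ?_ ?_ ?_
  · rintro ⟨h3, h4⟩
    rw [h3, h4] at ht
    exact h ht
  · rintro ⟨h3, h4⟩
    rw [h3, h4, hodd, hodd] at ht
    omega
  · intro h3
    rw [← hσ.1.1] at h3
    have := σ.injective h3
    omega

/-- The level sets of `theta` in `[-n, n]` are intervals, and `σ` can fail to ascend only at `r` and
its mirror image `1 - r`, where `theta` jumps. -/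
lemma IsMin.lt_of_theta_eq {n r : ℕ} (hr : 1 ≤ r) {σ : Equiv.Perm ℤ} (hσ : IsMin n r σ)
    {a b : ℤ} (h : a < b) (ha : -n ≤ a) (hb : b ≤ n) (ht : theta n r a = theta n r b) :
    σ a < σ b := by
  have step : ∀ j : ℤ, -n < j → j ≤ n → theta n r (j - 1) = theta n r j → σ (j - 1) < σ j := by
    intro j h1 h2 h3
    rcases le_or_gt 1 j with h4 | h4
    · refine hσ.2 j h4 h2 fun h5 => ?_
      unfold theta at h3
      split_ifs at h3 <;> omega
    · have := hσ.2 (1 - j) (by omega) (by omega) fun h5 => by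
        unfold theta at h3
        split_ifs at h3 <;> omega
      rw [show 1 - j - 1 = -j by ring, show 1 - j = -(j - 1) by ring, hσ.1.1, hσ.1.1] at this
      omega
  obtain ⟨d, rfl⟩ : ∃ d : ℕ, b = a + d + 1 := ⟨(b - a - 1).toNat, by omega⟩
  induction d with
  | zero =>
    have := step (a + 1) (by omega) (by simpa using hb) (by simpa using ht)
    simpa using this
  | succ d ih =>
    push_cast at *
    have h1 := theta_mono (n := n) hr (show a ≤ a + d + 1 by omega) ha (by omega)
    have h2 := theta_mono (n := n) hr (show a + d + 1 ≤ a + (d + 1) + 1 by omega)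
      (by omega) hb
    refine (ih (by omega) (by omega) (by omega)).trans ?_
    have := step (a + (d + 1) + 1) (by omega) hb
      (by rw [show a + ((d : ℤ) + 1) + 1 - 1 = a + d + 1 by ring]; omega)
    rwa [show a + ((d : ℤ) + 1) + 1 - 1 = a + d + 1 by ring] at this

/-- Compare with `σ⁻¹`: a pair inverted by `σ⁻¹` has preimages in distinct level sets of `theta`, as
`σ` is increasing on each of them, and so the weight inverts it too. -/
lemma IsMin.inversions_eq {n r : ℕ} (hr : 1 ≤ r) {σ : Equiv.Perm ℤ} (hσ : IsMin n r σ) :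
    inversions n σ = inversions n (wt n r σ) := by
  rw [← inversions_inv hσ.1]
  unfold inversions cnt
  congr 1
  refine filter_congr fun p hp => ?_
  rw [mem_pairs] at hp
  have h1 := abs_map_le (inv_mem hσ.1) (a := p.1) (abs_le.2 ⟨by omega, by omega⟩)
  have h2 := abs_map_le (inv_mem hσ.1) (a := p.2) (abs_le.2 ⟨by omega, by omega⟩)
  have e1 : σ (σ⁻¹ p.1) = p.1 := by simp
  have e2 : σ (σ⁻¹ p.2) = p.2 := by simp
  unfold wt
  generalize σ⁻¹ p.1 = a at *
  generalize σ⁻¹ p.2 = b at *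
  rw [abs_le] at h1 h2
  constructor
  · intro hba
    have h3 := theta_mono (n := n) hr hba.le h2.1 h1.2
    rcases eq_or_lt_of_le h3 with h4 | h4
    · have := hσ.lt_of_theta_eq hr hba h2.1 h1.2 h4
      omega
    · exact h4
  · intro h3
    by_contra h4
    have := theta_mono (n := n) hr (not_lt.1 h4) h1.1 h2.2
    omega

/-- The number of indices in `[-n, n]` at which `f` takes the value `1`. -/
def numOnes (n : ℕ) (f : ℤ → ℤ) : ℕ := ((Icc (-n : ℤ) n).filter fun a => f a = 1).card

lemma numOnes_comp {n : ℕ} {σ : Equiv.Perm ℤ} (hσ : σ ∈ signedPerms n) (f : ℤ → ℤ) :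
    numOnes n (f ∘ σ) = numOnes n f := by
  refine card_nbij' σ (σ⁻¹ : Equiv.Perm ℤ) ?_ ?_ ?_ ?_
  · intro a ha
    simp only [coe_filter, Set.mem_ofPred_eq, mem_Icc, ← abs_le, Function.comp_apply] at ha ⊢
    exact ⟨abs_map_le hσ ha.1, ha.2⟩
  · intro a ha
    simp only [coe_filter, Set.mem_ofPred_eq, mem_Icc, ← abs_le, Function.comp_apply] at ha ⊢
    exact ⟨abs_map_le (inv_mem hσ) ha.1, by simpa using ha.2⟩
  · intro a _; simp
  · intro a _; simp

lemma numOnes_theta {n r : ℕ} (hr : 1 ≤ r) : numOnes n (theta n r) = n + 1 - r := by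
  have : (Icc (-n : ℤ) n).filter (fun a => theta n r a = 1) = Icc (r : ℤ) n := by
    ext a
    simp only [mem_filter, mem_Icc, theta_eq_one]
    omega
  rw [numOnes, this, Int.card_Icc]
  omega

lemma numOnes_wt {n r : ℕ} (hr : 1 ≤ r) {σ : Equiv.Perm ℤ} (hσ : σ ∈ signedPerms n) :
    numOnes n (wt n r σ) = n + 1 - r := by
  rw [← numOnes_theta hr]
  exact numOnes_comp (inv_mem hσ) _

lemma eq_theta_of_monotone {n r : ℕ} (hr : 1 ≤ r) (hrn : r ≤ n) {f : ℤ → ℤ} (hf : f.Odd)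
    (hv : ∀ a, f a = -1 ∨ f a = 0 ∨ f a = 1) (hl : ∀ a : ℤ, (n : ℤ) < |a| → f a = 0)
    (hc : numOnes n f = n + 1 - r) (hm : ∀ i : ℤ, 1 ≤ i → i ≤ n → f (i - 1) ≤ f i) :
    f = theta n r := by
  have h0 : f 0 = 0 := hf.map_zero
  have mono : ∀ (d : ℕ) (a : ℤ), 0 ≤ a → a + d ≤ n → f a ≤ f (a + d) := by
    intro d
    induction d with
    | zero => intro a _ _; simp
    | succ d ih =>
      intro a ha hd
      have h1 := ih a ha (by push_cast at hd; omega)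
      have h2 := hm (a + d + 1) (by omega) (by push_cast at hd; omega)
      rw [show a + (d : ℤ) + 1 - 1 = a + d by ring] at h2
      push_cast
      rw [← add_assoc]
      omega
  have mono' : ∀ a b : ℤ, 0 ≤ a → a ≤ b → b ≤ n → f a ≤ f b := by
    intro a b h1 h2 h3
    have := mono (b - a).toNat a h1 (by omega)
    rwa [show a + ((b - a).toNat : ℤ) = b by omega] at this
  have nonneg : ∀ a : ℤ, 0 ≤ a → a ≤ n → 0 ≤ f a := fun a h1 h2 => by
    have := mono' 0 a le_rfl h1 h2
    omega
  have key : ∀ a : ℤ, 1 ≤ a → a ≤ n → (f a = 1 ↔ (r : ℤ) ≤ a) := by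
    intro a h1 h2
    constructor
    · intro h3
      -- By monotonicity every index from `a` to `n` carries a one, and there are only `n + 1 - r`
      -- ones.
      have : Icc a n ⊆ (Icc (-n : ℤ) n).filter fun b => f b = 1 := by
        intro b hb
        rw [mem_Icc] at hb
        rw [mem_filter, mem_Icc]
        refine ⟨by omega, ?_⟩
        have := mono' a b (by omega) hb.1 hb.2
        have := hv b
        omega
      have := card_le_card this
      rw [← numOnes, hc, Int.card_Icc] at this
      omega
    · intro h3
      by_contra h4
      -- If `f a` were not 1, all ones would lie above `a ≥ r`, which leaves fewer than `n + 1 - r`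
      -- places.
      have : (Icc (-n : ℤ) n).filter (fun b => f b = 1) ⊆ Icc (a + 1) n := by
        intro b hb
        rw [mem_filter, mem_Icc] at hb
        rw [mem_Icc]
        refine ⟨?_, by omega⟩
        by_contra h5
        rcases le_total 0 b with h6 | h6
        · have := mono' b a h6 (by omega) h2
          have := hv a
          omega
        · have := nonneg (-b) (by omega) (by omega)
          rw [hf] at this
          omega
      have := card_le_card this
      rw [← numOnes, hc, Int.card_Icc] at this
      omega
  have hpos : ∀ a : ℤ, 0 ≤ a → f a = theta n r a := by
    intro a ha
    by_cases h1 : (n : ℤ) < a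
    · rw [hl a (by rwa [abs_of_nonneg ha])]
      unfold theta; split_ifs <;> omega
    · rcases eq_or_lt_of_le ha with rfl | h2
      · rw [h0]; unfold theta; split_ifs <;> omega
      · have h3 := key a (by omega) (by omega)
        have h4 := nonneg a ha (by omega)
        have h5 := hv a
        unfold theta; split_ifs <;> omega
  ext a
  rcases le_total 0 a with h | h
  · exact hpos a h
  · have := hpos (-a) (by omega)
    rw [hf, theta_odd hr] at this
    omega

/-- Sort `f` by removing descents one at a time; the sorted function is `theta`, the weight of the
identity, and undoing the steps preserves minimality. -/
lemma exists_isMin {n r : ℕ} (hr : 1 ≤ r) (hrn : r ≤ n) {f : ℤ → ℤ} (hf : f.Odd)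
    (hv : ∀ a, f a = -1 ∨ f a = 0 ∨ f a = 1) (hl : ∀ a : ℤ, (n : ℤ) < |a| → f a = 0)
    (hc : numOnes n f = n + 1 - r) : ∃ σ, IsMin n r σ ∧ wt n r σ = f := by
  induction hk : inversions n f using Nat.strong_induction_on generalizing f with
  | _ k ih =>
    by_cases hm : ∀ i : ℤ, 1 ≤ i → i ≤ n → f (i - 1) ≤ f i
    · refine ⟨1, ⟨one_mem _, fun j _ _ _ => by simp⟩, ?_⟩
      rw [eq_theta_of_monotone hr hrn hf hv hl hc hm]
      rfl
    · push Not at hm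
      obtain ⟨i, h1, hn, h⟩ := hm
      have hg := sgPerm_mem (n := n) hn
      obtain ⟨σ, hσ, hw⟩ := ih (inversions n (f ∘ sg i))
        (by have := inversions_comp_sg_of_gt (n := n) hf h1 hn h; omega)
        (odd_comp hf (sg_odd i)) (fun a => hv _)
        (fun a ha => by simpa [sg_of_large hn ha] using hl a ha)
        ((numOnes_comp hg f).trans hc) rfl
      refine ⟨sgPerm i * σ, hσ.sgPerm_mul hr hn ?_, ?_⟩
      · rw [hw]
        intro h2
        rcases eq_or_lt_of_le h1 with rfl | h3
        · have := hf 1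
          have h0 : f 0 = 0 := hf.map_zero
          simp only [sub_self, Function.comp_apply, sg_zero, sg_one_one] at h2 h
          omega
        · simp only [Function.comp_apply, sg_self (show 2 ≤ i by omega),
            sg_pred (show 2 ≤ i by omega)] at h2
          omega
      · rw [wt_sgPerm_mul, hw]
        ext a
        simp [sg_sg]

lemma ofFn_eq_map_range {α : Type*} (n : ℕ) (f : ℕ → α) :
    List.ofFn (fun j : Fin n => f j) = (List.range n).map f := by
  rw [List.ofFn_eq_map, ← List.map_coe_finRange_eq_range, List.map_map]
  rfl

lemma eq_of_pairwise_lt {l l' : List ℤ} (h : l.Pairwise (· < ·)) (h' : l'.Pairwise (· < ·))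
    (hm : ∀ a, a ∈ l ↔ a ∈ l') : l = l' := by
  have hp : l.Perm l' := (List.perm_ext_iff_of_nodup (h.imp fun h => h.ne)
    (h'.imp fun h => h.ne)).2 hm
  exact hp.eq_of_pairwise (fun a b _ _ h1 h2 => absurd h1 h2.asymm) h h'

/-- The positions before `r` and those from `r` on are level sets of `theta`, on which `σ` is
increasing, so each half of the notation is the sorted list of the corresponding values. -/
lemma IsMin.oneLine {n r : ℕ} (hr : 1 ≤ r) (hrn : r ≤ n) {σ : Equiv.Perm ℤ} (hσ : IsMin n r σ)
    {A B : List ℤ} (hA : A.Pairwise (· < ·)) (hB : B.Pairwise (· < ·))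
    (hA' : ∀ p, p ∈ A ↔ 1 ≤ p ∧ p ≤ n ∧ wt n r σ p = 0) (hB' : ∀ p, p ∈ B ↔ wt n r σ p = 1) :
    List.ofFn (fun j : Fin n => σ ((j : ℤ) + 1)) = A ++ B := by
  rw [ofFn_eq_map_range n (fun j : ℕ => σ ((j : ℤ) + 1))]
  obtain ⟨q, rfl⟩ : ∃ q, r = q + 1 := ⟨r - 1, by omega⟩
  obtain ⟨m, rfl⟩ : ∃ m, n = q + m := ⟨n - q, by omega⟩
  rw [List.range_add, List.map_append, List.map_map]
  congr 1
  · refine eq_of_pairwise_lt ?_ hA fun p => ?_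
    · rw [List.pairwise_map]
      refine List.pairwise_lt_range.imp_of_mem ?_
      intro a b ha hb hab
      rw [List.mem_range] at ha hb
      refine hσ.lt_of_theta_eq hr (by omega) (by push_cast; omega) (by push_cast; omega) ?_
      unfold theta
      push_cast
      split_ifs <;> omega
    · rw [hA', List.mem_map]
      constructor
      · rintro ⟨j, hj, rfl⟩
        rw [List.mem_range] at hj
        have h1 := abs_map_le hσ.1 (a := (j : ℤ) + 1) (abs_le.2 ⟨by omega, by push_cast; omega⟩)
        have h2 := hσ.lt_of_theta_eq hr (a := 0) (b := (j : ℤ) + 1) (by omega)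
          (by omega) (by push_cast; omega) (by unfold theta; push_cast; split_ifs <;> omega)
        rw [map_zero_of_mem hσ.1] at h2
        rw [wt_apply]
        refine ⟨by omega, (abs_le.1 h1).2, ?_⟩
        unfold theta; push_cast; split_ifs <;> omega
      · rintro ⟨h1, h2, h3⟩
        have e1 : σ (σ⁻¹ p) = p := by simp
        have h4 := abs_map_le (inv_mem hσ.1) (a := p) (abs_le.2 ⟨by omega, h2⟩)
        -- On the zero level set `σ` is increasing and fixes `0`, so a nonpositive preimage cannot
        -- have a positive image.
        have h5 : 0 < σ⁻¹ p := by
          by_contra h5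
          have h6 : theta (q + m) (q + 1) (σ⁻¹ p) = 0 := h3
          rcases eq_or_lt_of_le (not_lt.1 h5) with h7 | h7
          · rw [h7, map_zero_of_mem hσ.1] at e1
            omega
          · have := hσ.lt_of_theta_eq hr h7 (abs_le.1 h4).1 (by omega)
              (by rw [h6, (theta_odd hr).map_zero])
            rw [e1, map_zero_of_mem hσ.1] at this
            omega
        refine ⟨(σ⁻¹ p - 1).toNat, ?_, ?_⟩
        · rw [List.mem_range]
          unfold wt theta at h3
          have := abs_le.1 h4
          push_cast at *
          split_ifs at h3 <;> omega
        · rw [show ((σ⁻¹ p - 1).toNat : ℤ) + 1 = σ⁻¹ p by omega, e1]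
  · refine eq_of_pairwise_lt ?_ hB fun p => ?_
    · rw [List.pairwise_map]
      refine List.pairwise_lt_range.imp_of_mem ?_
      intro a b ha hb hab
      rw [List.mem_range] at ha hb
      refine hσ.lt_of_theta_eq hr (by push_cast; omega) (by push_cast; omega)
        (by push_cast; omega) ?_
      unfold theta
      push_cast
      split_ifs <;> omega
    · rw [hB', List.mem_map]
      constructor
      · rintro ⟨j, hj, rfl⟩
        rw [List.mem_range] at hj
        simp only [Function.comp_apply]
        rw [wt_apply]
        unfold theta; push_cast; split_ifs <;> omega
      · intro h3
        have e1 : σ (σ⁻¹ p) = p := by simp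
        have h4 : ((q : ℤ) + 1 ≤ σ⁻¹ p) ∧ σ⁻¹ p ≤ q + m := by
          rw [wt, theta_eq_one] at h3
          push_cast at h3
          exact h3
        refine ⟨(σ⁻¹ p - 1 - q).toNat, ?_, ?_⟩
        · rw [List.mem_range]
          omega
        · simp only [Function.comp_apply]
          rw [show ((q + (σ⁻¹ p - 1 - q).toNat : ℕ) : ℤ) + 1 = σ⁻¹ p by push_cast; omega, e1]

lemma IsMin.eq_of_wt_eq {n r : ℕ} (hr : 1 ≤ r) (hrn : r ≤ n) {σ τ : Equiv.Perm ℤ}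
    (hσ : IsMin n r σ) (hτ : IsMin n r τ) (h : wt n r σ = wt n r τ) : σ = τ := by
  have hA : ∀ p, p ∈ ((Icc (1 : ℤ) n).filter fun p => wt n r σ p = 0).sort (· ≤ ·) ↔
      1 ≤ p ∧ p ≤ n ∧ wt n r σ p = 0 := fun p => by simp [and_assoc]
  have hB : ∀ p, p ∈ ((Icc (-n : ℤ) n).filter fun p => wt n r σ p = 1).sort (· ≤ ·) ↔
      wt n r σ p = 1 := fun p => by
    simp only [mem_sort, mem_filter, mem_Icc, ← abs_le, and_iff_right_iff_imp]
    intro h1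
    by_contra h2
    rw [wt_of_large hσ.1 (not_le.1 h2)] at h1
    omega
  have e1 := hσ.oneLine hr hrn (sortedLT_sort _).pairwise (sortedLT_sort _).pairwise hA hB
  have e2 := hτ.oneLine hr hrn (sortedLT_sort _).pairwise (sortedLT_sort _).pairwise
    (A := ((Icc (1 : ℤ) n).filter fun p => wt n r σ p = 0).sort (· ≤ ·))
    (B := ((Icc (-n : ℤ) n).filter fun p => wt n r σ p = 1).sort (· ≤ ·))
    (fun p => (hA p).trans (by rw [h])) (fun p => (hB p).trans (by rw [h]))
  have e3 := List.ofFn_injective (e1.trans e2.symm)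
  have e4 : ∀ a : ℤ, 1 ≤ a → a ≤ n → σ a = τ a := by
    intro a h1 h2
    have := congrFun e3 ⟨(a - 1).toNat, by omega⟩
    dsimp only at this
    rwa [show ((a - 1).toNat : ℤ) + 1 = a by omega] at this
  ext a
  by_cases ha : (n : ℤ) < |a|
  · rw [hσ.1.2 a ha, hτ.1.2 a ha]
  · have ha' := abs_le.1 (not_lt.1 ha)
    rcases lt_trichotomy a 0 with h0 | rfl | h0
    · have := e4 (-a) (by omega) (by omega)
      rw [hσ.1.1, hτ.1.1] at this
      omega
    · rw [map_zero_of_mem hσ.1, map_zero_of_mem hτ.1]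
    · exact e4 a (by omega) ha'.2

end

end SignedPerm

namespace SignedPerm

open Finset

noncomputable section

/-! ### Sums of blocks, and the effect of turning blocks over. -/

/-- The coordinates of `e i - e (i - 1)`, as an odd function of the index. -/
def blk (i a : ℤ) : ℤ :=
  (if a = i then 1 else 0) - (if a = i - 1 then 1 else 0) - (if -a = i then 1 else 0) +
    (if -a = i - 1 then 1 else 0)

/-- The coordinates of the sum of the `e i - e (i - 1)`, for `i` in a list. -/
def blkSum (l : List ℤ) (a : ℤ) : ℤ := (l.map fun i => blk i a).sum

@[simp] lemma blkSum_nil : blkSum [] = 0 := rfl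

@[simp] lemma blkSum_cons (i : ℤ) (l : List ℤ) : blkSum (i :: l) = blk i + blkSum l := by
  ext a; simp [blkSum]

lemma blk_odd (i : ℤ) : (blk i).Odd := fun a => by
  unfold blk; rw [neg_neg]; ring

lemma blkSum_odd (l : List ℤ) : (blkSum l).Odd := by
  induction l with
  | nil => intro a; simp
  | cons i l ih =>
    intro a
    simp only [blkSum_cons, Pi.add_apply, blk_odd i a, ih a]
    ring

/-- The lists of elements of `[1, n]` with gaps at least `2`. -/
def IsBlk (n : ℕ) (l : List ℤ) : Prop :=
  (∀ x ∈ l, 1 ≤ x ∧ x ≤ n) ∧ l.Pairwise fun x y => x + 2 ≤ y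

lemma IsBlk.tail {n : ℕ} {i : ℤ} {l : List ℤ} (h : IsBlk n (i :: l)) : IsBlk n l :=
  ⟨fun x hx => h.1 x (by simp [hx]), (List.pairwise_cons.1 h.2).2⟩

lemma IsBlk.head {n : ℕ} {i : ℤ} {l : List ℤ} (h : IsBlk n (i :: l)) :
    1 ≤ i ∧ i ≤ n ∧ ∀ j ∈ l, i + 2 ≤ j :=
  ⟨(h.1 i (by simp)).1, (h.1 i (by simp)).2, (List.pairwise_cons.1 h.2).1⟩

lemma IsBlk.succ_notMem {n : ℕ} {l : List ℤ} (h : IsBlk n l) {a : ℤ} (ha : a ∈ l) :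
    a + 1 ∉ l := by
  induction l with
  | nil => simp
  | cons i l ih =>
    have h1 := h.head.2.2
    rw [List.mem_cons] at ha ⊢
    rintro (h2 | h2)
    · rcases ha with rfl | ha
      · omega
      · have := h1 a ha
        omega
    · rcases ha with rfl | ha
      · have := h1 _ h2
        omega
      · exact ih h.tail ha h2

/-- The gaps keep the blocks disjoint: a positive index meets at most one block, as its upper or its
lower end. -/
lemma blkSum_apply {n : ℕ} {l : List ℤ} (h : IsBlk n l) {a : ℤ} (ha : 1 ≤ a) :
    blkSum l a = (if a ∈ l then 1 else 0) - (if a + 1 ∈ l then 1 else 0) := by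
  induction l with
  | nil => simp
  | cons i l ih =>
    obtain ⟨h1, h2, h3⟩ := h.head
    have h4 : i ∉ l := fun h => by have := h3 i h; omega
    rw [blkSum_cons, Pi.add_apply, ih h.tail]
    simp only [List.mem_cons]
    have e : blk i a = (if a = i then 1 else 0) - (if a + 1 = i then 1 else 0) := by
      unfold blk; split_ifs <;> omega
    rw [e]
    by_cases h5 : a = i
    · subst h5
      have h6 : a + 1 ∉ l := fun h => by have := h3 _ h; omega
      simp [h4, h6]
    · by_cases h6 : a + 1 = i
      · have h7 : a ∉ l := fun h => by have := h3 _ h; omega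
        subst h6
        simp [h4, h7]
      · simp [h5, h6]

lemma blkSum_range {n : ℕ} {l : List ℤ} (h : IsBlk n l) (a : ℤ) :
    blkSum l a = -1 ∨ blkSum l a = 0 ∨ blkSum l a = 1 := by
  rcases lt_trichotomy a 0 with h0 | rfl | h0
  · have := blkSum_apply h (a := -a) (by omega)
    rw [blkSum_odd] at this
    split_ifs at this <;> omega
  · right; left; exact (blkSum_odd l).map_zero
  · have := blkSum_apply h (a := a) (by omega)
    split_ifs at this <;> omega

lemma blkSum_of_large {n : ℕ} {l : List ℤ} (h : IsBlk n l) {a : ℤ} (ha : (n : ℤ) < |a|) :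
    blkSum l a = 0 := by
  have key : ∀ a : ℤ, n < a → blkSum l a = 0 := fun a ha => by
    rw [blkSum_apply h (by omega), if_neg, if_neg]
    · rfl
    · intro h1; have := h.1 _ h1; omega
    · intro h1; have := h.1 _ h1; omega
  rcases lt_abs.1 ha with h1 | h1
  · exact key a h1
  · have := key _ h1
    rw [blkSum_odd] at this
    omega

lemma blkSum_eq_one {n : ℕ} {l : List ℤ} (h : IsBlk n l) {a : ℤ} :
    blkSum l a = 1 ↔ a ∈ l ∨ (a ≤ -1 ∧ 1 - a ∈ l) := by
  rcases lt_trichotomy a 0 with h0 | rfl | h0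
  · have := blkSum_apply h (a := -a) (by omega)
    have h1 : a ∉ l := fun h1 => by have := h.1 _ h1; omega
    rw [blkSum_odd, show -a + 1 = 1 - a by ring] at this
    by_cases h2 : 1 - a ∈ l
    · have h3 : -a ∉ l := fun h3 => h.succ_notMem h3 (by rwa [show -a + 1 = 1 - a by ring])
      simp only [h2, h3, if_true, if_false] at this
      simp only [h1, h2, and_true, false_or]
      omega
    · simp only [h2, if_false] at this
      simp only [h1, h2, and_false, false_or, iff_false]
      split_ifs at this <;> omega
  · have h1 : (0 : ℤ) ∉ l := fun h1 => by have := h.1 _ h1; omega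
    rw [(blkSum_odd l).map_zero]
    simp [h1]
  · have := blkSum_apply h (a := a) (by omega)
    by_cases h2 : a ∈ l
    · have h3 := h.succ_notMem h2
      simp only [h2, h3, if_true, if_false] at this
      simp [h2, this]
    · simp only [h2, if_false] at this
      simp only [h2, false_or]
      split_ifs at this <;> omega

lemma blkSum_eq_neg_one {n : ℕ} {l : List ℤ} (h : IsBlk n l) {a : ℤ} :
    -blkSum l a = 1 ↔ -a ∈ l ∨ (1 ≤ a ∧ a + 1 ∈ l) := by
  rw [← blkSum_odd, blkSum_eq_one h, show 1 - -a = a + 1 by ring]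
  simp only [neg_le_neg_iff]

lemma blkSum_eq_zero {n : ℕ} {l : List ℤ} (h : IsBlk n l) {a : ℤ} (ha : 1 ≤ a) :
    blkSum l a = 0 ↔ a ∉ l ∧ a + 1 ∉ l := by
  have h1 := blkSum_apply h ha
  have h2 := h.succ_notMem (a := a)
  by_cases h3 : a ∈ l <;> by_cases h4 : a + 1 ∈ l <;> simp_all

lemma sg_eq_iff {i a b : ℤ} : sg i a = b ↔ a = sg i b := by
  constructor
  · rintro rfl; rw [sg_sg]
  · rintro rfl; rw [sg_sg]

lemma sg_of_lt {i a : ℤ} (ha : 0 ≤ a) (h : a + 1 < i) : sg i a = a := by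
  unfold sg; split_ifs <;> omega

lemma sg_of_gt {i a : ℤ} (h : i < a) : sg i a = a := by
  unfold sg; split_ifs <;> omega

lemma blk_comp_sg_of_fix {i j : ℤ} (h1 : sg j i = i) (h2 : sg j (i - 1) = i - 1) :
    blk i ∘ sg j = blk i := by
  ext a
  simp only [Function.comp_apply, blk, ← sg_neg, sg_eq_iff, h1, h2]

lemma blk_comp_sg_of_lt {i j : ℤ} (hi : 1 ≤ i) (h : i + 2 ≤ j) : blk i ∘ sg j = blk i :=
  blk_comp_sg_of_fix (sg_of_lt (by omega) (by omega)) (sg_of_lt (by omega) (by omega))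

lemma blk_comp_sg_of_gt {i j : ℤ} (h : i + 2 ≤ j) : blk j ∘ sg i = blk j :=
  blk_comp_sg_of_fix (sg_of_gt (by omega)) (sg_of_gt (by omega))

lemma blk_comp_sg_self {i : ℤ} (hi : 1 ≤ i) : blk i ∘ sg i = -blk i := by
  ext a
  simp only [Function.comp_apply, blk, Pi.neg_apply]
  unfold sg
  split_ifs <;> omega

lemma blkSum_comp_sg {i : ℤ} {l : List ℤ} (h : ∀ j ∈ l, i + 2 ≤ j) :
    blkSum l ∘ sg i = blkSum l := by
  induction l with
  | nil => rfl
  | cons j l ih =>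
    rw [blkSum_cons]
    ext a
    have h1 := congrFun (blk_comp_sg_of_gt (h j (by simp))) a
    have h2 := congrFun (ih fun k hk => h k (by simp [hk])) a
    simp only [Function.comp_apply, Pi.add_apply] at *
    rw [h1, h2]

/-- Applying the simple reflections of a list of blocks changes the sign of the blocks. -/
lemma flip_step {n : ℕ} {i : ℤ} {l : List ℤ} (h : IsBlk n (i :: l)) {g : ℤ → ℤ} (hg : g.Odd)
    (hi : g ∘ sg i = g) :
    (g + blk i - blkSum l) ∘ sg i = g - blkSum (i :: l) ∧
      (g + blk i - blkSum l) (i - 1) < (g + blk i - blkSum l) i := by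
  obtain ⟨h1, h2, h3⟩ := h.head
  constructor
  · have e1 := blk_comp_sg_self h1
    have e2 := blkSum_comp_sg h3
    ext a
    have e1 := congrFun e1 a
    have e2 := congrFun e2 a
    have e3 := congrFun hi a
    simp only [Function.comp_apply, Pi.add_apply, Pi.sub_apply, Pi.neg_apply, blkSum_cons] at *
    omega
  · have e1 : blkSum l i = 0 := by
      rw [blkSum_eq_zero h.tail h1]
      exact ⟨fun h => by have := h3 _ h; omega, fun h => by have := h3 _ h; omega⟩
    simp only [Pi.add_apply, Pi.sub_apply, e1]
    rcases eq_or_lt_of_le h1 with rfl | h4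
    · have e2 := congrFun hi 1
      have e3 := hg 1
      simp only [Function.comp_apply, sg_one_one] at e2
      simp only [sub_self, hg.map_zero, (blkSum_odd l).map_zero, (blk_odd 1).map_zero]
      simp only [blk]
      norm_num
      omega
    · have e2 := congrFun hi i
      rw [Function.comp_apply, sg_self (by omega)] at e2
      have e3 : blkSum l (i - 1) = 0 := by
        rw [blkSum_eq_zero h.tail (by omega)]
        exact ⟨fun h => by have := h3 _ h; omega, fun h => by have := h3 _ h; omega⟩
      rw [e2, e3]
      simp only [blk]
      split_ifs <;> omega

lemma comp_sg_add_blk {n : ℕ} {i : ℤ} {l : List ℤ} (h : IsBlk n (i :: l)) {g : ℤ → ℤ}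
    (hg : ∀ j ∈ i :: l, g ∘ sg j = g) : ∀ j ∈ l, (g + blk i) ∘ sg j = g + blk i := by
  intro j hj
  obtain ⟨h1, h2, h3⟩ := h.head
  ext a
  have e1 := congrFun (hg j (by simp [hj])) a
  have e2 := congrFun (blk_comp_sg_of_lt h1 (h3 j hj)) a
  simp only [Function.comp_apply, Pi.add_apply] at *
  omega

lemma odd_add_blk {g : ℤ → ℤ} (hg : g.Odd) (i : ℤ) : (g + blk i).Odd := fun a => by
  simp only [Pi.add_apply, hg a, blk_odd i a]; ring

/-- The tail of the list is turned over first, while block `i` is still positive and can be absorbed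
into `g`; then `s_i` acts at a strict ascent and adds one inversion. -/
lemma inversions_flip {n : ℕ} {l : List ℤ} (h : IsBlk n l) {g : ℤ → ℤ} (hg : g.Odd)
    (hi : ∀ j ∈ l, g ∘ sg j = g) :
    inversions n (g - blkSum l) = inversions n (g + blkSum l) + l.length := by
  induction l generalizing g with
  | nil => simp
  | cons i l ih =>
    have e1 := ih h.tail (odd_add_blk hg i) (comp_sg_add_blk h hi)
    obtain ⟨e2, e3⟩ := flip_step h hg (hi i (by simp))
    have e4 : (g + blk i - blkSum l).Odd := fun a => by
      simp only [Pi.sub_apply, odd_add_blk hg i a, blkSum_odd l a]; ring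
    have e5 := inversions_comp_sg (n := n) e4 h.head.1 h.head.2.1 e3
    rw [← e2, e5, e1, blkSum_cons, ← add_assoc, List.length_cons]
    omega

/-- The same induction as in `inversions_flip`: the strict ascent at each step keeps the
representative minimal. -/
lemma IsMin.flip {n r : ℕ} (hr : 1 ≤ r) {l : List ℤ} (h : IsBlk n l) {g : ℤ → ℤ} (hg : g.Odd)
    (hi : ∀ j ∈ l, g ∘ sg j = g) {σ : Equiv.Perm ℤ} (hσ : IsMin n r σ)
    (hw : wt n r σ = g + blkSum l) :
    IsMin n r (wordPerm l * σ) ∧ wt n r (wordPerm l * σ) = g - blkSum l := by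
  induction l generalizing g with
  | nil => exact ⟨by simpa [wordPerm] using hσ, by simpa [wordPerm] using hw⟩
  | cons i l ih =>
    obtain ⟨e1, e1'⟩ := ih h.tail (odd_add_blk hg i) (comp_sg_add_blk h hi)
      (by rw [hw, blkSum_cons, add_assoc])
    obtain ⟨e2, e3⟩ := flip_step h hg (hi i (by simp))
    have e4 : wordPerm (i :: l) * σ = sgPerm i * (wordPerm l * σ) := by
      simp [wordPerm, mul_assoc]
    rw [e4]
    refine ⟨e1.sgPerm_mul hr h.head.2.1 ?_, ?_⟩
    · rw [e1']; exact e3.ne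
    · rw [wt_sgPerm_mul, e1', e2]

lemma IsMin.wordPerm_mul {n r : ℕ} (hr : 1 ≤ r) {l : List ℤ} (h : IsBlk n l)
    {σ : Equiv.Perm ℤ} (hσ : IsMin n r σ) (hw : wt n r σ = blkSum l) :
    IsMin n r (wordPerm l * σ) ∧ wt n r (wordPerm l * σ) = -blkSum l := by
  have := hσ.flip hr h (g := 0) (fun a => by simp) (fun j _ => rfl) (by rw [hw, zero_add])
  simpa using this

/-- All permutations whose weight is minus a sum of `m` blocks have the same length. -/
lemma IsMin.two_mul_inversions {n r : ℕ} (hr : 1 ≤ r) {l : List ℤ} (h : IsBlk n l)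
    {σ : Equiv.Perm ℤ} (hσ : IsMin n r σ) (hw : wt n r σ = -blkSum l) :
    2 * inversions n σ = distinct n (theta n r) + l.length := by
  rw [hσ.inversions_eq hr, ← distinct_comp (inv_mem hσ.1) (theta_odd hr)]
  change _ = distinct n (wt n r σ) + _
  -- This gives the sum of the inversions of the block sum and its negative; `inversions_flip` gives
  -- their difference.
  rw [hw, ← inversions_add_inversions_neg, neg_neg]
  have := inversions_flip h (g := 0) (fun a => by simp) (fun j _ => rfl)
  rw [zero_sub, zero_add] at this
  omega

/-! ### Tail sums, and the functions from which no descent can be undone. -/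

/-- `f i + ⋯ + f n`. -/
def tailSum (n : ℕ) (f : ℤ → ℤ) (i : ℤ) : ℤ := ∑ k ∈ Icc i n, f k

lemma tailSum_of_gt {n : ℕ} (f : ℤ → ℤ) {i : ℤ} (h : n < i) : tailSum n f i = 0 := by
  rw [tailSum, Icc_eq_empty (by omega), sum_empty]

lemma tailSum_eq {n : ℕ} (f : ℤ → ℤ) {i : ℤ} (h : i ≤ n) :
    tailSum n f i = f i + tailSum n f (i + 1) := by
  have : Icc i (n : ℤ) = insert i (Icc (i + 1) (n : ℤ)) := by
    ext a; simp only [mem_Icc, mem_insert]; omega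
  rw [tailSum, this, sum_insert (by simp), tailSum]

lemma tailSum_induction {n : ℕ} {P : ℤ → Prop} (h0 : P (n + 1))
    (h1 : ∀ i : ℤ, 1 ≤ i → i ≤ n → P (i + 1) → P i) {i : ℤ} (hi : 1 ≤ i) (hn : i ≤ n + 1) :
    P i := by
  obtain ⟨d, hd⟩ : ∃ d : ℕ, i = n + 1 - d := ⟨(n + 1 - i).toNat, by omega⟩
  induction d generalizing i with
  | zero => rw [hd]; simpa using h0
  | succ d ih =>
    push_cast at hd
    exact h1 i hi (by omega) (ih (by omega) (by omega) (by omega))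

/-- A tail starting elsewhere contains both or neither of the swapped indices `i - 1` and `i`. For
`i = 1` the correction is `f (-1) - f 1`. -/
lemma tailSum_comp_sg {n : ℕ} (f : ℤ → ℤ) {i j : ℤ} (h1 : 1 ≤ i)
    (hn : i ≤ n) (hj : 1 ≤ j) (hjn : j ≤ n + 1) :
    tailSum n (f ∘ sg i) j = tailSum n f j + if j = i then f (sg i i) - f i else 0 := by
  refine tailSum_induction (P := fun j => tailSum n (f ∘ sg i) j =
    tailSum n f j + if j = i then f (sg i i) - f i else 0) ?_ ?_ hj hjn
  · rw [tailSum_of_gt _ (by omega), tailSum_of_gt _ (by omega), if_neg (by omega)]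
    rfl
  · intro k hk hkn ih
    rw [tailSum_eq _ hkn, ih, tailSum_eq f hkn, Function.comp_apply]
    by_cases e1 : k = i
    · subst e1
      rw [if_pos rfl, if_neg (by omega)]
      omega
    · by_cases e2 : k + 1 = i
      · rw [if_pos e2, if_neg e1, sg_self (by omega), show k = i - 1 by omega,
          sg_pred (by omega)]
        omega
      · rw [if_neg e2, if_neg e1]
        have : sg i k = k := by
          rcases lt_or_gt_of_ne e1 with h | h
          · exact sg_of_lt (by omega) (by omega)
          · exact sg_of_gt h
        rw [this]
        omega

lemma tailSum_blkSum {n : ℕ} {l : List ℤ} (h : IsBlk n l) {i : ℤ} (h1 : 1 ≤ i) (hn : i ≤ n + 1) :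
    tailSum n (blkSum l) i = if i ∈ l then 1 else 0 := by
  refine tailSum_induction (P := fun i => tailSum n (blkSum l) i = if i ∈ l then 1 else 0)
    ?_ ?_ h1 hn
  · rw [tailSum_of_gt _ (by omega), if_neg]
    intro h2
    have := h.1 _ h2
    omega
  · intro k hk hkn ih
    rw [tailSum_eq _ hkn, ih, blkSum_apply h hk]
    omega

/-- An odd function with nonpositive tail sums whose tail sums do not stay nonpositive after
undoing any of its descents is minus a sum of blocks. -/
lemma exists_blkSum_of_stuck {n : ℕ} {f : ℤ → ℤ} (hf : f.Odd)
    (hv : ∀ a, f a = -1 ∨ f a = 0 ∨ f a = 1) (hl : ∀ a : ℤ, (n : ℤ) < |a| → f a = 0)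
    (hs : ∀ i : ℤ, 1 ≤ i → i ≤ n → tailSum n f i ≤ 0)
    (hstuck : ∀ i : ℤ, 1 ≤ i → i ≤ n → f i < f (i - 1) →
      ¬∀ j : ℤ, 1 ≤ j → j ≤ n → tailSum n (f ∘ sg i) j ≤ 0) :
    ∃ l, IsBlk n l ∧ f = -blkSum l := by
  have h0 : f 0 = 0 := hf.map_zero
  have hs' : ∀ i : ℤ, 1 ≤ i → i ≤ n + 1 → tailSum n f i ≤ 0 := fun i h1 h2 => by
    by_cases h3 : i ≤ n
    · exact hs i h1 h3
    · rw [tailSum_of_gt _ (by omega)]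
  -- Only the tail sum at `i` changes, so that is the one that becomes positive.
  have stuck : ∀ i : ℤ, 1 ≤ i → i ≤ n → f i < f (i - 1) →
      0 < tailSum n f i + f (sg i i) - f i := by
    intro i h1 hn hi
    by_contra h
    refine hstuck i h1 hn hi fun j hj hjn => ?_
    rw [tailSum_comp_sg f h1 hn hj (by omega)]
    split_ifs with h2
    · subst h2; omega
    · have := hs j hj hjn; omega
  -- After the swap the tail sum is `f (i - 1) + tailSum n f (i + 1)`; being positive, it forces `f
  -- (i - 1) = 1` and a zero tail. Nonpositivity at `i - 1` then gives `f i = -1`.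
  have stuck2 : ∀ i : ℤ, 2 ≤ i → i ≤ n → f i < f (i - 1) →
      f (i - 1) = 1 ∧ f i = -1 ∧ tailSum n f (i + 1) = 0 := by
    intro i h1 hn hi
    have e1 := stuck i (by omega) hn hi
    rw [sg_self h1] at e1
    have e2 := tailSum_eq f hn
    have e3 := tailSum_eq f (show i - 1 ≤ n by omega)
    rw [show i - 1 + 1 = i by ring] at e3
    have e4 := hs' (i + 1) (by omega) (by omega)
    have e5 := hs' (i - 1) (by omega) (by omega)
    have e6 := hs' i (by omega) (by omega)
    have := hv i
    have := hv (i - 1)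
    omega
  -- Past each `-1` the tail sum vanishes. Index `1` is a descent from `f 0 = 0`, where the sign
  -- change adds 2 to the tail sum; two consecutive `-1` are excluded by induction.
  have neg : ∀ k : ℕ, (k : ℤ) + 1 ≤ n → f (k + 1) = -1 → tailSum n f (k + 2) = 0 := by
    intro k
    induction k with
    | zero =>
      intro hn h
      have e1 := stuck 1 le_rfl (by omega) (by simpa [h0] using (show f 1 < 0 by simp_all))
      simp only [Nat.cast_zero, zero_add] at *
      rw [sg_one_one, hf] at e1
      have e2 := tailSum_eq f hn
      have e3 := hs' 2 (by omega) (by omega)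
      norm_num at e2
      omega
    | succ k ih =>
      intro hn h
      push_cast at *
      have e2 := tailSum_eq f hn
      rw [add_assoc (k : ℤ) 1 1, add_assoc _ (1 + 1) (1 : ℤ)] at e2
      norm_num at e2
      rw [add_assoc (k : ℤ) 1 2]
      norm_num
      have e3 := hs' (k + 3) (by omega) (by omega)
      rw [add_assoc] at h
      norm_num at h
      by_cases h2 : f (k + 1) = -1
      · have := ih (by omega) h2
        rw [h] at e2
        omega
      · have := hv (k + 1)
        have e4 := stuck2 (k + 2) (by omega) (by omega)
        rw [show (k : ℤ) + 2 - 1 = k + 1 by ring, show (k : ℤ) + 2 + 1 = k + 3 by ring] at e4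
        exact (e4 (by omega)).2.2
  have neg' : ∀ i : ℤ, 1 ≤ i → i ≤ n → f i = -1 → tailSum n f (i + 1) = 0 := by
    intro i h1 h2 h3
    have := neg (i - 1).toNat
    rw [show ((i - 1).toNat : ℤ) + 1 = i by omega,
      show ((i - 1).toNat : ℤ) + 2 = i + 1 by omega] at this
    exact this h2 h3
  have blk1 : ∀ i : ℤ, 2 ≤ i → i ≤ n → f i = -1 → f (i - 1) = 1 := by
    intro i h1 h2 h3
    by_cases h4 : f (i - 1) = -1
    · have e1 := neg' (i - 1) (by omega) (by omega) h4
      rw [show i - 1 + 1 = i by ring] at e1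
      have e2 := tailSum_eq f h2
      have e3 := hs' (i + 1) (by omega) (by omega)
      omega
    · have := hv (i - 1)
      exact (stuck2 i h1 h2 (by omega)).1
  -- Downward induction: if `1, 1` occurred at `i, i + 1`, the second would be cancelled by a `-1`
  -- with zero tail beyond it, leaving the tail sum at `i` equal to 1.
  have blk2 : ∀ i : ℤ, 1 ≤ i → i ≤ n + 1 → f i = 1 → f (i + 1) = -1 := by
    intro i h1 h2
    refine tailSum_induction (n := n) (P := fun i => f i = 1 → f (i + 1) = -1) ?_ ?_ h1 h2
    · intro h
      rw [hl _ (by rw [abs_of_nonneg] <;> omega)] at h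
      omega
    · intro i h1 h2 ih h3
      have e1 := tailSum_eq f h2
      have e2 := hs' i h1 (by omega)
      rcases eq_or_lt_of_le h2 with h4 | h4
      · rw [tailSum_of_gt f (show (n : ℤ) < i + 1 by omega)] at e1
        omega
      by_cases h5 : f (i + 1) = 1
      · have h6 := ih h5
        have h7 : i + 2 ≤ n := by
          by_contra h7
          rw [hl _ (by rw [abs_of_nonneg] <;> omega)] at h6
          omega
        have e3 := stuck2 (i + 2) (by omega) h7
        rw [show i + 2 - 1 = i + 1 by ring, show i + 1 + 1 = i + 2 by ring] at *
        have e4 := (e3 (by omega)).2.2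
        have e5 := tailSum_eq f h7
        have e6 := tailSum_eq f (show i + 1 ≤ n by omega)
        rw [show i + 1 + 1 = i + 2 by ring] at e6
        omega
      · have e3 := stuck2 (i + 1) (by omega) (by omega)
        rw [show i + 1 - 1 = i by ring] at e3
        have := hv (i + 1)
        exact (e3 (by omega)).2.1
  -- A block is located by its `-1`; each one at an index `i ≥ 2` has its partner `1` at `i - 1`,
  -- while one at index 1 is the block of `α_1`.
  set l := ((Icc (1 : ℤ) n).filter fun i => f i = -1).sort (· ≤ ·) with hldef
  have hmem : ∀ a, a ∈ l ↔ (1 ≤ a ∧ a ≤ n) ∧ f a = -1 := fun a => by simp [hldef]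
  have hblk : IsBlk n l := by
    refine ⟨fun x hx => ((hmem x).1 hx).1, ?_⟩
    have : l.Pairwise (· < ·) := (sortedLT_sort _).pairwise
    refine this.imp_of_mem ?_
    intro a b ha hb hab
    rw [hmem] at ha hb
    by_contra h
    have := blk1 b (by omega) hb.1.2 hb.2
    rw [show b - 1 = a by omega] at this
    omega
  refine ⟨l, hblk, ?_⟩
  have hpos : ∀ a : ℤ, 1 ≤ a → f a = -blkSum l a := by
    intro a ha
    by_cases h1 : a ≤ n
    · rw [blkSum_apply hblk ha]
      simp only [hmem]
      have e1 := blk1 (a + 1) (by omega)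
      rw [show a + 1 - 1 = a by ring] at e1
      have e2 := blk2 a ha (by omega)
      have e3 := hv a
      have e4 : ¬ a + 1 ≤ n → f (a + 1) = 0 := fun h =>
        hl _ (by rw [abs_of_nonneg] <;> omega)
      split_ifs <;> omega
    · rw [hl a (by rw [abs_of_nonneg] <;> omega),
        blkSum_of_large hblk (by rw [abs_of_nonneg] <;> omega)]
      rfl
  ext a
  rw [Pi.neg_apply]
  rcases lt_trichotomy a 0 with h | rfl | h
  · have := hpos (-a) (by omega)
    rw [hf, blkSum_odd] at this
    omega
  · rw [h0, (blkSum_odd l).map_zero]; rfl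
  · exact hpos a (by omega)

/-- A negated block at `i` has ones at `-i` and at `i - 1`, except that for `i = 1` the second is
missing. -/
lemma numOnes_neg_blkSum {n : ℕ} {l : List ℤ} (h : IsBlk n l) :
    numOnes n (-blkSum l) + (if 1 ∈ l then 1 else 0) = 2 * l.length := by
  have hnd : l.Nodup := h.2.imp fun h => by omega
  have hcard : l.toFinset.card = l.length := List.toFinset_card_of_nodup hnd
  have : (Icc (-n : ℤ) n).filter (fun a => (-blkSum l) a = 1) =
      l.toFinset.image (fun a => -a) ∪ (l.toFinset.erase 1).image (fun a => a - 1) := by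
    ext a
    simp only [mem_filter, mem_Icc, Pi.neg_apply, blkSum_eq_neg_one h, mem_union, mem_image,
      List.mem_toFinset, mem_erase]
    constructor
    · rintro ⟨h1, h2 | h2⟩
      · exact Or.inl ⟨-a, h2, by ring⟩
      · exact Or.inr ⟨a + 1, ⟨by omega, h2.2⟩, by ring⟩
    · rintro (⟨b, hb, rfl⟩ | ⟨b, ⟨hb1, hb⟩, rfl⟩)
      · have := h.1 b hb
        exact ⟨by omega, Or.inl (by rwa [neg_neg])⟩
      · have := h.1 b hb
        exact ⟨by omega, Or.inr ⟨by omega, by rwa [sub_add_cancel]⟩⟩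
  rw [numOnes, this, card_union_of_disjoint, card_image_of_injective, card_image_of_injective,
    card_erase_eq_ite, hcard]
  · simp only [List.mem_toFinset]
    split_ifs with h1
    · have := List.length_pos_of_mem h1
      omega
    · omega
  · intro a b; simp
  · intro a b; simp
  · rw [disjoint_left]
    simp only [mem_image, List.mem_toFinset, mem_erase]
    rintro a ⟨b, hb, rfl⟩ ⟨c, hc, h1⟩
    have := h.1 b hb
    have := h.1 c hc.2
    omega

lemma numOnes_neg {n : ℕ} {f : ℤ → ℤ} (hf : f.Odd) : numOnes n (-f) = numOnes n f := by
  refine card_nbij' (fun a => -a) (fun a => -a) ?_ ?_ ?_ ?_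
  · intro a ha
    simp only [coe_filter, Set.mem_ofPred_eq, mem_Icc, Pi.neg_apply] at ha ⊢
    rw [hf]
    omega
  · intro a ha
    simp only [coe_filter, Set.mem_ofPred_eq, mem_Icc, Pi.neg_apply] at ha ⊢
    rw [hf]
    omega
  · intro a _; simp
  · intro a _; simp

end

end SignedPerm

namespace BCType

open Finset SignedPerm

noncomputable section

/-! ### Coordinates in the Euclidean space. -/

lemma e_neg (n : ℕ) (a : ℤ) : e n (-a) = -e n a := by
  ext k
  simp only [e, PiLp.neg_apply]
  split_ifs <;> first | omega | norm_num

lemma e_of_large {n : ℕ} {a : ℤ} (h : (n : ℤ) < |a|) : e n a = 0 := by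
  ext k
  have hk : (k : ℤ) + 1 ≤ n := by omega
  simp only [e, PiLp.zero_apply]
  rcases lt_abs.1 h with h | h <;> rw [if_neg (by omega), if_neg (by omega)]

lemma e_zero (n : ℕ) : e n 0 = 0 := by
  ext k
  simp only [e, PiLp.zero_apply]
  rw [if_neg (by omega), if_neg (by omega)]

lemma e_succ (n : ℕ) (k : Fin n) : e n ((k : ℤ) + 1) = EuclideanSpace.single k 1 := by
  ext j
  simp only [e, PiLp.single_apply]
  by_cases h : j = k
  · simp [h]
  · have : (k : ℤ) ≠ j := fun h' => h (Fin.ext (by omega))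
    rw [if_neg (by omega), if_neg (by omega), if_neg h]

/-- The coordinates of a vector, as an odd function of the index. -/
def coord {n : ℕ} (v : V n) (a : ℤ) : ℝ := inner ℝ (e n a) v

lemma coord_neg {n : ℕ} (v : V n) (a : ℤ) : coord v (-a) = -coord v a := by
  rw [coord, e_neg, inner_neg_left, coord]

lemma coord_of_large {n : ℕ} (v : V n) {a : ℤ} (h : (n : ℤ) < |a|) : coord v a = 0 := by
  rw [coord, e_of_large h, inner_zero_left]

lemma coord_zero {n : ℕ} (v : V n) : coord v 0 = 0 := by
  rw [coord, e_zero, inner_zero_left]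

lemma coord_succ {n : ℕ} (v : V n) (k : Fin n) : coord v ((k : ℤ) + 1) = v k := by
  rw [coord, e_succ, EuclideanSpace.inner_single_left]
  simp

lemma coord_eq {n : ℕ} (v : V n) {a : ℤ} (h1 : 1 ≤ a) (hn : a ≤ n) :
    coord v a = v ⟨(a - 1).toNat, by omega⟩ := by
  rw [← coord_succ]
  congr 1
  simp only
  omega

lemma coord_e {n : ℕ} {a : ℤ} (h1 : 1 ≤ a) (hn : a ≤ n) (b : ℤ) :
    coord (e n b) a = (if a = b then 1 else 0) - (if a = -b then 1 else 0) := by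
  rw [coord_eq _ h1 hn]
  simp only [e]
  split_ifs <;> first | omega | norm_num

lemma eq_of_coord_eq {n : ℕ} {v v' : V n} (h : ∀ a : ℤ, 1 ≤ a → a ≤ n → coord v a = coord v' a) :
    v = v' := by
  ext k
  rw [← coord_succ, ← coord_succ]
  exact h _ (by omega) (by omega)

lemma coord_add {n : ℕ} (v v' : V n) (a : ℤ) : coord (v + v') a = coord v a + coord v' a :=
  inner_add_right _ _ _

lemma coord_sub {n : ℕ} (v v' : V n) (a : ℤ) : coord (v - v') a = coord v a - coord v' a :=
  inner_sub_right _ _ _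

lemma coord_neg_vec {n : ℕ} (v : V n) (a : ℤ) : coord (-v) a = -coord v a :=
  inner_neg_right _ _

lemma e_injOn {n : ℕ} {a b : ℤ} (ha : |a| ≤ n) (hb : |b| ≤ n) (h : e n a = e n b) : a = b := by
  rw [abs_le] at ha hb
  by_contra hab
  have key : ∀ c : ℤ, 1 ≤ c → c ≤ n → ((if c = a then (1 : ℝ) else 0) - (if c = -a then 1 else 0) =
      (if c = b then 1 else 0) - (if c = -b then 1 else 0)) := fun c h1 h2 => by
    rw [← coord_e h1 h2, ← coord_e h1 h2, h]
  rcases lt_trichotomy a 0 with h0 | rfl | h0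
  · have := key (-a) (by omega) (by omega)
    split_ifs at this <;> first | omega | norm_num at this
  · rcases lt_or_gt_of_ne hab with h1 | h1
    · have := key b (by omega) (by omega)
      split_ifs at this <;> first | omega | norm_num at this
    · have := key (-b) (by omega) (by omega)
      split_ifs at this <;> first | omega | norm_num at this
  · have := key a (by omega) (by omega)
    split_ifs at this <;> first | omega | norm_num at this

/-! ### The Weyl group as the group of signed permutations. -/

/-- The isometry `w` permutes the `e a` as the signed permutation `σ` permutes their indices. -/
def Rep (n : ℕ) (w : V n ≃ₗᵢ[ℝ] V n) (σ : Equiv.Perm ℤ) : Prop :=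
  σ ∈ signedPerms n ∧ ∀ a, w (e n a) = e n (σ a)

lemma Rep.mul {n : ℕ} {w w' : V n ≃ₗᵢ[ℝ] V n} {σ σ' : Equiv.Perm ℤ} (h : Rep n w σ)
    (h' : Rep n w' σ') : Rep n (w * w') (σ * σ') :=
  ⟨mul_mem h.1 h'.1, fun a => by
    change w (w' (e n a)) = _
    rw [h'.2, h.2, Equiv.Perm.mul_apply]⟩

lemma Rep.one (n : ℕ) : Rep n 1 1 := ⟨one_mem _, fun _ => rfl⟩

lemma Rep.inv {n : ℕ} {w : V n ≃ₗᵢ[ℝ] V n} {σ : Equiv.Perm ℤ} (h : Rep n w σ) :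
    Rep n w⁻¹ σ⁻¹ :=
  ⟨inv_mem h.1, fun a => by
    apply w.injective
    rw [h.2, show σ (σ⁻¹ a) = a by simp]
    exact w.apply_symm_apply _⟩

lemma Rep.eq {n : ℕ} {w w' : V n ≃ₗᵢ[ℝ] V n} {σ : Equiv.Perm ℤ} (h : Rep n w σ)
    (h' : Rep n w' σ) : w = w' := by
  have : w.toLinearEquiv.toLinearMap = w'.toLinearEquiv.toLinearMap := by
    refine (EuclideanSpace.basisFun (Fin n) ℝ).toBasis.ext fun k => ?_
    simp only [OrthonormalBasis.coe_toBasis, EuclideanSpace.basisFun_apply, ← e_succ]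
    exact (h.2 _).trans (h'.2 _).symm
  ext1 v
  exact LinearMap.congr_fun this v

lemma Rep.unique {n : ℕ} {w : V n ≃ₗᵢ[ℝ] V n} {σ τ : Equiv.Perm ℤ} (h : Rep n w σ)
    (h' : Rep n w τ) : σ = τ := by
  ext a
  by_cases ha : (n : ℤ) < |a|
  · rw [h.1.2 a ha, h'.1.2 a ha]
  · rw [not_lt] at ha
    exact e_injOn (abs_map_le h.1 ha) (abs_map_le h'.1 ha) ((h.2 a).symm.trans (h'.2 a))

lemma Rep.coord {n : ℕ} {w : V n ≃ₗᵢ[ℝ] V n} {σ : Equiv.Perm ℤ} (h : Rep n w σ) (v : V n)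
    (a : ℤ) : BCType.coord (w v) a = BCType.coord v (σ⁻¹ a) := by
  have : e n a = w (e n (σ⁻¹ a)) := by rw [h.2]; simp
  rw [BCType.coord, this, LinearIsometryEquiv.inner_map_map, BCType.coord]

/-- The length of the vector `α_i` in units of `e i - e (i - 1)`. -/
def rootScale (t : BCType) (i : ℤ) : ℝ := if i = 1 then t.specialLength else 1

lemma specialLength_pos (t : BCType) : 0 < t.specialLength := by
  cases t <;> norm_num [specialLength]

lemma rootScale_pos (t : BCType) (i : ℤ) : 0 < rootScale t i := by
  unfold rootScale
  split_ifs
  exacts [specialLength_pos t, one_pos]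

lemma simpleRoot_eq (t : BCType) (n : ℕ) (i : ℤ) :
    simpleRoot t n i = rootScale t i • (e n i - e n (i - 1)) := by
  unfold simpleRoot rootScale
  split_ifs with h
  · rw [h, sub_self, e_zero, sub_zero]
  · rw [one_smul]

lemma inner_e {n : ℕ} {a : ℤ} (h1 : 1 ≤ a) (hn : a ≤ n) (b : ℤ) :
    inner ℝ (e n a) (e n b) = (if a = b then (1 : ℝ) else 0) - (if a = -b then 1 else 0) :=
  coord_e h1 hn b

lemma refl_smul {n : ℕ} {c : ℝ} (hc : 0 < c) (β : V n) : refl n (c • β) = refl n β := by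
  simp only [refl, Submodule.span_singleton_smul_eq (IsUnit.mk0 c hc.ne') β]

lemma refl_of_inner_eq_zero {n : ℕ} {β v : V n} (h : inner ℝ β v = 0) : refl n β v = v :=
  Submodule.reflection_mem_subspace_eq_self (Submodule.mem_orthogonal_singleton_iff_inner_right.2 h)

lemma refl_self {n : ℕ} (β : V n) : refl n β β = -β :=
  Submodule.reflection_orthogonalComplement_singleton_eq_neg β

lemma rep_s (t : BCType) {n : ℕ} {i : ℤ} (h1 : 1 ≤ i) (hn : i ≤ n) :
    Rep n (s t n i) (sgPerm i) := by
  refine ⟨sgPerm_mem hn, ?_⟩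
  have hs : s t n i = refl n (e n i - e n (i - 1)) := by
    rw [s, simpleRoot_eq, refl_smul (rootScale_pos t i)]
  have key : ∀ a : ℤ, 1 ≤ a → a ≤ n → s t n i (e n a) = e n (sg i a) := by
    intro a ha han
    rw [hs]
    rcases eq_or_lt_of_le h1 with rfl | h2
    · rw [sub_self, e_zero, sub_zero]
      rcases eq_or_lt_of_le ha with rfl | h3
      · rw [refl_self, sg_one_one, e_neg]
      · rw [sg_of_gt h3, refl_of_inner_eq_zero]
        rw [inner_e le_rfl hn, if_neg (by omega), if_neg (by omega), sub_self]
    · have hnorm : ∀ b : ℤ, 1 ≤ b → b ≤ n → ‖e n b‖ = 1 := by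
        intro b hb hbn
        rw [← sq_eq_sq₀ (norm_nonneg _) zero_le_one, ← real_inner_self_eq_norm_sq,
          inner_e hb hbn, if_pos rfl, if_neg (by omega)]
        norm_num
      have e1 : refl n (e n i - e n (i - 1)) (e n i) = e n (i - 1) :=
        Submodule.reflection_sub ((hnorm i h1 hn).trans (hnorm (i - 1) (by omega)
          (by omega)).symm)
      rcases eq_or_ne a i with rfl | h3
      · rw [sg_self (by omega), e1]
      · rcases eq_or_ne a (i - 1) with rfl | h4
        · rw [sg_pred (by omega)]
          -- The image of `e (i - 1)` follows from that of `e i`, because a reflection is an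
          -- involution.
          exact (congrArg (refl n (e n i - e n (i - 1))) e1.symm).trans
            (Submodule.reflection_reflection _ _)
        · have h5 : sg i a = a := by
            rcases lt_or_gt_of_ne h3 with h | h
            · exact sg_of_lt (by omega) (by omega)
            · exact sg_of_gt h
          rw [h5, refl_of_inner_eq_zero]
          rw [inner_sub_left, inner_e h1 hn, inner_e (by omega) (by omega),
            if_neg (by omega), if_neg (by omega), if_neg (by omega), if_neg (by omega)]
          norm_num
  intro a
  rw [sgPerm_apply]
  by_cases ha : (n : ℤ) < |a|
  · rw [sg_of_large hn ha, e_of_large ha, map_zero]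
  · rw [not_lt, abs_le] at ha
    rcases lt_trichotomy a 0 with h0 | rfl | h0
    · have := key (-a) (by omega) (by omega)
      rwa [e_neg, map_neg, sg_neg, e_neg, neg_inj] at this
    · rw [sg_zero, e_zero, map_zero]
    · exact key a (by omega) ha.2

lemma rep_wordProd (t : BCType) {n : ℕ} {l : List ℤ} (hl : ∀ i ∈ l, 1 ≤ i ∧ i ≤ (n : ℤ)) :
    Rep n (wordProd t n l) (wordPerm l) := by
  induction l with
  | nil => exact Rep.one n
  | cons i l ih =>
    have hi := hl i (by simp)
    have := (rep_s t hi.1 hi.2).mul (ih fun j hj => hl j (by simp [hj]))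
    simpa [wordProd, wordPerm] using this

lemma exists_rep {t : BCType} {n : ℕ} {w : V n ≃ₗᵢ[ℝ] V n} (hw : w ∈ weylGroup t n) :
    ∃ σ, Rep n w σ := by
  induction hw using Subgroup.closure_induction with
  | mem x hx =>
    obtain ⟨i, hi, rfl⟩ := hx
    exact ⟨_, rep_s t hi.1 hi.2⟩
  | one => exact ⟨1, Rep.one n⟩
  | mul x y _ _ hx hy =>
    obtain ⟨σ, hσ⟩ := hx
    obtain ⟨τ, hτ⟩ := hy
    exact ⟨_, hσ.mul hτ⟩
  | inv x _ hx =>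
    obtain ⟨σ, hσ⟩ := hx
    exact ⟨_, hσ.inv⟩

lemma wordProd_mem (t : BCType) {n : ℕ} {l : List ℤ} (hl : ∀ i ∈ l, 1 ≤ i ∧ i ≤ (n : ℤ)) :
    wordProd t n l ∈ weylGroup t n := by
  refine Subgroup.list_prod_mem _ fun x hx => ?_
  obtain ⟨i, hi, rfl⟩ := List.mem_map.1 hx
  exact Subgroup.subset_closure ⟨i, hl i hi, rfl⟩

lemma Rep.mem_weylGroup (t : BCType) {n : ℕ} {w : V n ≃ₗᵢ[ℝ] V n} {σ : Equiv.Perm ℤ}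
    (h : Rep n w σ) : w ∈ weylGroup t n := by
  obtain ⟨l, hl, -, rfl⟩ := exists_wordPerm_eq h.1
  rw [h.eq (rep_wordProd t hl)]
  exact wordProd_mem t hl

lemma exists_of_mem_signedPerms (t : BCType) {n : ℕ} {σ : Equiv.Perm ℤ}
    (h : σ ∈ signedPerms n) : ∃ w, Rep n w σ := by
  obtain ⟨l, hl, -, rfl⟩ := exists_wordPerm_eq h
  exact ⟨_, rep_wordProd t hl⟩

/-- Bubble sort provides a word of this length, and a word cannot create more inversions than it has
letters. -/
lemma Rep.length_eq (t : BCType) {n : ℕ} {w : V n ≃ₗᵢ[ℝ] V n} {σ : Equiv.Perm ℤ}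
    (h : Rep n w σ) : length t n w = inversions n σ := by
  obtain ⟨l, hl, hlen, hw⟩ := exists_wordPerm_eq h.1
  have hmem : inversions n σ ∈ {k | ∃ l : List ℤ, (∀ i ∈ l, i ∈ Set.Icc (1 : ℤ) n) ∧
      l.length = k ∧ wordProd t n l = w} :=
    ⟨l, hl, hlen, (rep_wordProd t hl).eq (hw ▸ h)⟩
  refine le_antisymm (Nat.sInf_le hmem) ?_
  obtain ⟨l', hl', hlen', hw'⟩ := Nat.sInf_mem ⟨_, hmem⟩
  have hσ : σ = wordPerm l' := h.unique (hw' ▸ rep_wordProd t hl')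
  rw [length, ← hlen', hσ]
  exact inversions_wordPerm_le hl'

/-! ### The dominance order, positive roots and fundamental weights. -/

/-- The vector `e i + ⋯ + e n`. -/
def tailVec (n : ℕ) (i : ℤ) : V n := ∑ k ∈ Icc i n, e n k

lemma inner_tailVec {n : ℕ} (i : ℤ) (v : V n) :
    inner ℝ (tailVec n i) v = ∑ k ∈ Icc i n, coord v k := by
  rw [tailVec, sum_inner]
  rfl

lemma tailVec_eq {n : ℕ} {i : ℤ} (h : i ≤ n) : tailVec n i = e n i + tailVec n (i + 1) := by
  have : Icc i (n : ℤ) = insert i (Icc (i + 1) (n : ℤ)) := by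
    ext a; simp only [mem_Icc, mem_insert]; omega
  rw [tailVec, this, sum_insert (by simp), tailVec]

lemma inner_tailVec_e {n : ℕ} {i : ℤ} (h1 : 1 ≤ i) (j : ℤ) :
    inner ℝ (tailVec n i) (e n j) =
      (if i ≤ j ∧ j ≤ n then (1 : ℝ) else 0) - (if i ≤ -j ∧ -j ≤ n then 1 else 0) := by
  have : ∀ k ∈ Icc i (n : ℤ), coord (e n j) k =
      (if k = j then (1 : ℝ) else 0) - (if k = -j then 1 else 0) := fun k hk =>
    coord_e (h1.trans (mem_Icc.1 hk).1) (mem_Icc.1 hk).2 j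
  rw [inner_tailVec, sum_congr rfl this, sum_sub_distrib, sum_ite_eq', sum_ite_eq']
  simp only [mem_Icc]

lemma inner_tailVec_simpleRoot (t : BCType) {n : ℕ} {i j : ℤ} (hi : 1 ≤ i) (hj : 1 ≤ j)
    (hjn : j ≤ n) : inner ℝ (tailVec n i) (simpleRoot t n j) =
      if i = j then rootScale t j else 0 := by
  rw [simpleRoot_eq, real_inner_smul_right, inner_sub_right, inner_tailVec_e hi,
    inner_tailVec_e hi, if_neg (c := i ≤ -j ∧ _) (by omega),
    if_neg (c := i ≤ -(j - 1) ∧ _) (by omega)]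
  split_ifs <;> first | omega | simp

lemma eq_of_inner_tailVec_eq {n : ℕ} {v v' : V n}
    (h : ∀ i : ℤ, 1 ≤ i → i ≤ n → inner ℝ (tailVec n i) v = inner ℝ (tailVec n i) v') :
    v = v' := by
  have h' : ∀ i : ℤ, 1 ≤ i → inner ℝ (tailVec n i) v = inner ℝ (tailVec n i) v' := fun i h1 => by
    by_cases hn : i ≤ n
    · exact h i h1 hn
    · rw [tailVec, Icc_eq_empty hn, sum_empty, inner_zero_left, inner_zero_left]
  refine eq_of_coord_eq fun a h1 hn => ?_
  have e1 := h' a h1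
  rw [tailVec_eq hn, inner_add_left, inner_add_left, h' (a + 1) (by omega)] at e1
  exact add_right_cancel e1

/-- The tail vectors form, up to positive factors, the basis dual to the simple roots, so these
inner products have the signs of the coefficients. -/
lemma isNonneg_iff (t : BCType) {n : ℕ} (x : V n) :
    IsNonneg t n x ↔ ∀ i : ℤ, 1 ≤ i → i ≤ n → 0 ≤ inner ℝ (tailVec n i) x := by
  have key : ∀ (c : ℤ → ℝ) (i : ℤ), 1 ≤ i → i ≤ n →
      inner ℝ (tailVec n i) (∑ j ∈ Icc (1 : ℤ) n, c j • simpleRoot t n j) =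
        c i * rootScale t i := by
    intro c i h1 hn
    have : ∀ j ∈ Icc (1 : ℤ) n, inner ℝ (tailVec n i) (c j • simpleRoot t n j) =
        if i = j then c j * rootScale t j else 0 := fun j hj => by
      rw [real_inner_smul_right, inner_tailVec_simpleRoot t h1 (mem_Icc.1 hj).1
        (mem_Icc.1 hj).2, mul_ite, mul_zero]
    rw [inner_sum, sum_congr rfl this, sum_ite_eq, if_pos (mem_Icc.2 ⟨h1, hn⟩)]
  constructor
  · rintro ⟨c, hc, rfl⟩ i h1 hn
    rw [key c i h1 hn]
    exact mul_nonneg (hc i (mem_Icc.2 ⟨h1, hn⟩)) (rootScale_pos t i).le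
  · intro h
    refine ⟨fun j => inner ℝ (tailVec n j) x / rootScale t j, fun j hj => ?_, ?_⟩
    · rw [mem_Icc] at hj
      exact div_nonneg (h j hj.1 hj.2) (rootScale_pos t j).le
    · refine eq_of_inner_tailVec_eq fun i h1 hn => ?_
      rw [key _ i h1 hn, div_mul_cancel₀ _ (rootScale_pos t i).ne']

lemma isNonneg_e_sub_e (t : BCType) {n : ℕ} {a b : ℤ} (ha : |a| ≤ n) (hb : |b| ≤ n) (h : a ≠ b)
    {c : ℝ} (hc : 0 < c) : IsNonneg t n (c • (e n b - e n a)) ↔ a < b := by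
  rw [isNonneg_iff]
  rw [abs_le] at ha hb
  have key : ∀ i : ℤ, 1 ≤ i → inner ℝ (tailVec n i) (c • (e n b - e n a)) =
      c * (((if i ≤ b ∧ b ≤ n then (1 : ℝ) else 0) - (if i ≤ -b ∧ -b ≤ n then 1 else 0)) -
        ((if i ≤ a ∧ a ≤ n then (1 : ℝ) else 0) - (if i ≤ -a ∧ -a ≤ n then 1 else 0))) :=
    fun i h1 => by
      rw [real_inner_smul_right, inner_sub_right, inner_tailVec_e h1, inner_tailVec_e h1]
  constructor
  · intro h1
    by_contra h2
    -- If `b < a`, the coefficient at index `a`, or at `-b` when `a ≤ 0`, is negative.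
    rcases lt_or_ge 0 a with h3 | h3
    · have := h1 a (by omega) (by omega)
      rw [key a (by omega), mul_nonneg_iff_of_pos_left hc] at this
      split_ifs at this <;> first | omega | norm_num at this
    · have := h1 (-b) (by omega) (by omega)
      rw [key (-b) (by omega), mul_nonneg_iff_of_pos_left hc] at this
      split_ifs at this <;> first | omega | norm_num at this
  · intro h1 i h2 h3
    rw [key i h2]
    refine mul_nonneg hc.le ?_
    split_ifs <;> first | omega | norm_num

lemma Rep.map_simpleRoot (t : BCType) {n : ℕ} {w : V n ≃ₗᵢ[ℝ] V n} {σ : Equiv.Perm ℤ}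
    (h : Rep n w σ) (j : ℤ) :
    w (simpleRoot t n j) = rootScale t j • (e n (σ j) - e n (σ (j - 1))) := by
  rw [simpleRoot_eq, map_smul, map_sub, h.2, h.2]

lemma Rep.map_simpleRoot_mem_posRoots (t : BCType) {n : ℕ} {w : V n ≃ₗᵢ[ℝ] V n}
    {σ : Equiv.Perm ℤ} (h : Rep n w σ) {j : ℤ} (h1 : 1 ≤ j) (hn : j ≤ n) :
    w (simpleRoot t n j) ∈ posRoots t n ↔ σ (j - 1) < σ j := by
  have b1 := abs_map_le h.1 (a := j) (abs_le.2 ⟨by omega, hn⟩)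
  have b2 := abs_map_le h.1 (a := j - 1) (abs_le.2 ⟨by omega, by omega⟩)
  have b3 := Int.one_le_abs (map_ne_zero h.1 (show j ≠ 0 by omega))
  have hroot : w (simpleRoot t n j) ∈ roots t n := by
    rw [h.map_simpleRoot t j]
    rcases eq_or_ne j 1 with rfl | hj
    · left
      refine ⟨σ 1, b3, b1, ?_⟩
      rw [sub_self, map_zero_of_mem h.1, e_zero, sub_zero, rootScale, if_pos rfl]
    · right
      refine ⟨σ j, -σ (j - 1), b3, b1, ?_, by rwa [abs_neg], ?_, ?_⟩
      · rw [abs_neg]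
        exact Int.one_le_abs (map_ne_zero h.1 (by omega))
      · rw [abs_neg]
        intro hab
        rcases abs_eq_abs.1 hab with h3 | h3
        · have := σ.injective h3
          omega
        · rw [← h.1.1] at h3
          have := σ.injective h3
          omega
      · rw [rootScale, if_neg hj, one_smul, e_neg, sub_eq_add_neg]
  rw [posRoots, Set.mem_ofPred_eq, and_iff_right hroot, h.map_simpleRoot t j,
    isNonneg_e_sub_e t b2 b1 (fun h3 => by have := σ.injective h3; omega) (rootScale_pos t j)]

lemma Rep.mem_minReps_iff (t : BCType) {n r : ℕ} {w : V n ≃ₗᵢ[ℝ] V n} {σ : Equiv.Perm ℤ}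
    (h : Rep n w σ) : w ∈ minReps t n {(r : ℤ)} ↔ IsMin n r σ := by
  constructor
  · rintro ⟨-, h2⟩
    exact ⟨h.1, fun j h1 hn hj => (h.map_simpleRoot_mem_posRoots t h1 hn).1
      (h2 j ⟨h1, hn⟩ hj)⟩
  · intro h2
    exact ⟨h.mem_weylGroup t, fun j hj hjr => (h.map_simpleRoot_mem_posRoots t hj.1 hj.2).2
      (h2.2 j hj.1 hj.2 hjr)⟩

/-- Pairing with `α_j` measures the difference of the coordinates at `j` and `j - 1`, so the
coordinates jump only at `r`. -/
lemma exists_coord_fundamentalWeight {t : BCType} {n r : ℕ} (hr : 1 ≤ r) (hrn : r ≤ n)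
    {ω : V n} (hω : IsFundamentalWeight t n r ω) :
    ∃ c : ℝ, 0 < c ∧ (2 ≤ r → c = 1) ∧ ∀ a, coord ω a = c * (theta n r a : ℝ) := by
  have hlen : ∀ j : ℤ, 1 ≤ j → j ≤ n → inner ℝ (e n j - e n (j - 1)) (e n j - e n (j - 1)) =
      if j = 1 then (1 : ℝ) else 2 := by
    intro j h1 hn
    rcases eq_or_ne j 1 with rfl | hj
    · rw [sub_self, e_zero, sub_zero, inner_e h1 hn]
      norm_num
    · rw [inner_sub_left, inner_sub_right, inner_sub_right, inner_e h1 hn, inner_e h1 hn,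
        inner_e (by omega) (by omega), inner_e (by omega) (by omega)]
      split_ifs <;> first | omega | norm_num
  have hstep : ∀ j : ℤ, 1 ≤ j → j ≤ n → coord ω j - coord ω (j - 1) =
      if j = r then rootScale t r * (if (r : ℤ) = 1 then 1 else 2) / 2 else 0 := by
    intro j h1 hn
    have h2 := hω j (mem_Icc.2 ⟨h1, hn⟩)
    have hs := rootScale_pos t j
    rw [simpleRoot_eq, real_inner_smul_right, real_inner_smul_right, real_inner_smul_left,
      real_inner_comm, hlen j h1 hn, inner_sub_left] at h2
    change 2 * (rootScale t j * (coord ω j - coord ω (j - 1))) / _ = _ at h2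
    have hpos : (0 : ℝ) < if j = 1 then 1 else 2 := by split_ifs <;> norm_num
    rw [div_eq_iff (by positivity)] at h2
    by_cases h3 : j = r
    · subst h3
      rw [if_pos rfl] at h2 ⊢
      have := mul_left_cancel₀ hs.ne' (show rootScale t r * (2 * (coord ω r - coord ω (r - 1))) =
        rootScale t r * (rootScale t r * if (r : ℤ) = 1 then 1 else 2) by linarith)
      linarith
    · rw [if_neg h3] at h2 ⊢
      rw [zero_mul] at h2
      have := mul_eq_zero.1 (show rootScale t j * (coord ω j - coord ω (j - 1)) = 0 by linarith)
      exact this.resolve_left hs.ne'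
  -- This is `1/2` in type `B_n` with `r = 1`, and `1` in all other cases.
  set c := rootScale t r * (if (r : ℤ) = 1 then 1 else 2) / 2 with hc
  have hcpos : 0 < c := by
    have := rootScale_pos t r
    rw [hc]
    split_ifs <;> positivity
  refine ⟨c, hcpos, fun h2 => ?_, ?_⟩
  · rw [hc, rootScale, if_neg (by omega), if_neg (by omega)]
    norm_num
  have hnat : ∀ k : ℕ, k ≤ n → coord ω k = c * (theta n r k : ℝ) := by
    intro k
    induction k with
    | zero =>
      intro _
      have : theta n r 0 = 0 := (theta_odd hr).map_zero
      rw [Nat.cast_zero, coord_zero, this]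
      simp
    | succ k ih =>
      intro hk
      have h1 := ih (by omega)
      have h2 := hstep ((k + 1 : ℕ) : ℤ) (by omega) (by omega)
      rw [show ((k + 1 : ℕ) : ℤ) - 1 = k by push_cast; ring, h1] at h2
      have h3 : theta n r ((k + 1 : ℕ) : ℤ) = theta n r k + if ((k + 1 : ℕ) : ℤ) = r then 1 else 0 := by
        unfold theta
        split_ifs <;> omega
      rw [h3]
      split_ifs at h2 ⊢
      · push_cast at *; linarith
      · push_cast at *; linarith
  intro a
  by_cases ha : (n : ℤ) < |a|
  · rw [coord_of_large ω ha]
    have : theta n r a = 0 := by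
      unfold theta
      rcases lt_abs.1 ha with h | h <;> (split_ifs <;> omega)
    simp [this]
  · rw [not_lt, abs_le] at ha
    rcases le_total 0 a with h | h
    · lift a to ℕ using h
      exact hnat a (by omega)
    · have := hnat (-a).toNat (by omega)
      rw [show ((-a).toNat : ℤ) = -a by omega, coord_neg, theta_odd hr] at this
      push_cast at this
      linarith

end

end BCType

namespace BCType

open Finset SignedPerm

noncomputable section

/-! ### The minimal elements are the block elements. -/

lemma BruhatLE.eq_or_length_lt {t : BCType} {n : ℕ} {u w : V n ≃ₗᵢ[ℝ] V n}
    (h : BruhatLE t n u w) : u = w ∨ length t n u < length t n w := by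
  induction h with
  | refl => exact Or.inl rfl
  | tail _ h2 ih =>
    obtain ⟨β, -, -, h3⟩ := h2
    rcases ih with rfl | ih
    · exact Or.inr h3
    · exact Or.inr (ih.trans h3)

lemma simpleRoot_mem_roots (t : BCType) {n : ℕ} {i : ℤ} (h1 : 1 ≤ i) (hn : i ≤ n) :
    simpleRoot t n i ∈ roots t n := by
  rcases eq_or_ne i 1 with rfl | hi
  · left
    exact ⟨1, by simp, by simpa using hn, by rw [simpleRoot, if_pos rfl]⟩
  · right
    refine ⟨i, -(i - 1), ?_, ?_, ?_, ?_, ?_, ?_⟩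
    all_goals first
      | rw [simpleRoot, if_neg hi, e_neg, sub_eq_add_neg]
      | (rw [abs_neg, abs_of_pos (show 0 < i by omega), abs_of_pos (show 0 < i - 1 by omega)]
         omega)
      | (rw [abs_neg, abs_of_pos (show 0 < i - 1 by omega)]; omega)
      | (rw [abs_of_pos (show 0 < i by omega)]; omega)

lemma exists_isMin_of_mem_minReps {t : BCType} {n r : ℕ} {w : V n ≃ₗᵢ[ℝ] V n}
    (h : w ∈ minReps t n {(r : ℤ)}) : ∃ σ, Rep n w σ ∧ IsMin n r σ := by
  obtain ⟨σ, hσ⟩ := exists_rep h.1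
  exact ⟨σ, hσ, (hσ.mem_minReps_iff t).1 h⟩

lemma tailSum_neg (n : ℕ) (f : ℤ → ℤ) (i : ℤ) : tailSum n (-f) i = -tailSum n f i := by
  simp [tailSum]

/-- `ω` is a positive multiple of `e r + ⋯ + e n`. -/
def HasScale (n r : ℕ) (ω : V n) (c : ℝ) : Prop :=
  0 < c ∧ ∀ a, coord ω a = c * (theta n r a : ℝ)

lemma Rep.coord_weight {n r : ℕ} {ω : V n} {c : ℝ} (hω : HasScale n r ω c)
    {w : V n ≃ₗᵢ[ℝ] V n} {σ : Equiv.Perm ℤ} (h : Rep n w σ) (a : ℤ) :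
    BCType.coord (w ω) a = c * (wt n r σ a : ℝ) := by
  rw [h.coord, hω.2, wt]

lemma Rep.isNonpos_iff (t : BCType) {n r : ℕ} {ω : V n} {c : ℝ} (hω : HasScale n r ω c)
    {w : V n ≃ₗᵢ[ℝ] V n} {σ : Equiv.Perm ℤ} (h : Rep n w σ) :
    IsNonpos t n (w ω) ↔ ∀ i : ℤ, 1 ≤ i → i ≤ n → tailSum n (wt n r σ) i ≤ 0 := by
  rw [IsNonpos, isNonneg_iff]
  refine forall_congr' fun i => forall_congr' fun _ => forall_congr' fun _ => ?_
  have : inner ℝ (tailVec n i) (-w ω) = c * (-tailSum n (wt n r σ) i : ℤ) := by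
    rw [inner_neg_right, inner_tailVec, sum_congr rfl fun k _ => h.coord_weight hω k, ← mul_sum,
      tailSum]
    push_cast
    ring
  rw [this, mul_nonneg_iff_of_pos_left hω.1, Int.cast_nonneg_iff]
  omega

lemma Rep.eq_of_apply_eq {n r : ℕ} (hr : 1 ≤ r) (hrn : r ≤ n) {ω : V n} {c : ℝ}
    (hω : HasScale n r ω c) {u w : V n ≃ₗᵢ[ℝ] V n} {σ τ : Equiv.Perm ℤ} (hu : Rep n u σ)
    (hw : Rep n w τ) (hσ : IsMin n r σ) (hτ : IsMin n r τ) (h : u ω = w ω) : u = w := by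
  have : wt n r σ = wt n r τ := by
    ext a
    have h1 := hu.coord_weight hω a
    rw [h, hw.coord_weight hω a] at h1
    exact_mod_cast (mul_left_cancel₀ hω.1.ne' h1).symm
  rw [hσ.eq_of_wt_eq hr hrn hτ this] at hu
  exact hu.eq hw

/-- The representing permutation is minimal, and its weight is minus a sum of blocks. -/
def IsBlockElt (n r : ℕ) (w : V n ≃ₗᵢ[ℝ] V n) (l : List ℤ) : Prop :=
  IsBlk n l ∧ ∃ σ, Rep n w σ ∧ IsMin n r σ ∧ wt n r σ = -blkSum l

/-- Undo descents by left multiplication while the tail sums stay nonpositive. Each step lowers the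
length by one, so the process stops, at minus a block sum. -/
lemma exists_isBlockElt_bruhatLE (t : BCType) {n r : ℕ} (hr : 1 ≤ r) {w : V n ≃ₗᵢ[ℝ] V n}
    {σ : Equiv.Perm ℤ} (h : Rep n w σ) (hσ : IsMin n r σ)
    (hs : ∀ i : ℤ, 1 ≤ i → i ≤ n → tailSum n (wt n r σ) i ≤ 0) :
    ∃ u l, IsBlockElt n r u l ∧ BruhatLE t n u w := by
  induction hk : inversions n σ using Nat.strong_induction_on generalizing w σ with
  | _ k ih =>
    by_cases hstuck : ∀ i : ℤ, 1 ≤ i → i ≤ n → wt n r σ i < wt n r σ (i - 1) →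
        ¬∀ j : ℤ, 1 ≤ j → j ≤ n → tailSum n (wt n r σ ∘ sg i) j ≤ 0
    · obtain ⟨l, hl, hw⟩ := exists_blkSum_of_stuck (wt_odd hr h.1) (wt_range n r σ)
        (fun a ha => wt_of_large h.1 ha) hs hstuck
      exact ⟨w, l, ⟨hl, σ, h, hσ, hw⟩, Relation.ReflTransGen.refl⟩
    · push Not at hstuck
      obtain ⟨i, h1, hn, hi, hs'⟩ := hstuck
      have hmin : IsMin n r (sgPerm i * σ) := hσ.sgPerm_mul hr hn hi.ne'
      have hrep : Rep n (s t n i * w) (sgPerm i * σ) := (rep_s t h1 hn).mul h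
      have hinv : inversions n (sgPerm i * σ : Equiv.Perm ℤ) + 1 = inversions n σ := by
        rw [hmin.inversions_eq hr, hσ.inversions_eq hr, wt_sgPerm_mul]
        exact inversions_comp_sg_of_gt (wt_odd hr h.1) h1 hn hi
      obtain ⟨u, l, hu, hle⟩ := ih _ (by omega) hrep hmin (by rwa [wt_sgPerm_mul]) rfl
      refine ⟨u, l, hu, hle.tail ⟨simpleRoot t n i, simpleRoot_mem_roots t h1 hn, ?_, ?_⟩⟩
      · refine h.eq ?_
        have := (rep_s t h1 hn).mul hrep
        rwa [← mul_assoc (sgPerm i), sgPerm_mul_self, one_mul] at this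
      · rw [hrep.length_eq t, h.length_eq t]
        omega

lemma IsBlockElt.two_mul_length {n r : ℕ} (hr : 1 ≤ r) {w : V n ≃ₗᵢ[ℝ] V n} {l : List ℤ}
    (h : IsBlockElt n r w l) :
    n + 1 - r + (if 1 ∈ l then 1 else 0) = 2 * l.length := by
  obtain ⟨hl, σ, hw, hσ, hwt⟩ := h
  rw [← numOnes_neg_blkSum hl, ← hwt, numOnes_wt hr hσ.1]

lemma IsBlockElt.length_eq_length (t : BCType) {n r : ℕ} (hr : 1 ≤ r) {w w' : V n ≃ₗᵢ[ℝ] V n}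
    {l l' : List ℤ} (h : IsBlockElt n r w l) (h' : IsBlockElt n r w' l') :
    length t n w = length t n w' := by
  have e1 := h.two_mul_length hr
  have e2 := h'.two_mul_length hr
  obtain ⟨hl, σ, hw, hσ, hwt⟩ := h
  obtain ⟨hl', σ', hw', hσ', hwt'⟩ := h'
  have e3 := hσ.two_mul_inversions hr hl hwt
  have e4 := hσ'.two_mul_inversions hr hl' hwt'
  rw [hw.length_eq t, hw'.length_eq t]
  -- By parity the two lists agree on whether 1 occurs, hence have the same length.
  split_ifs at e1 e2 <;> omega

lemma IsBlockElt.mem {t : BCType} {n r : ℕ} {ω : V n} {c : ℝ}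
    (hω : HasScale n r ω c) {w : V n ≃ₗᵢ[ℝ] V n} {l : List ℤ} (h : IsBlockElt n r w l) :
    w ∈ minReps t n {(r : ℤ)} ∧ IsNonpos t n (w ω) := by
  obtain ⟨hl, σ, hw, hσ, hwt⟩ := h
  refine ⟨(hw.mem_minReps_iff t).2 hσ, (hw.isNonpos_iff t hω).2 fun i h1 hn => ?_⟩
  rw [hwt, tailSum_neg, tailSum_blkSum hl h1 (by omega)]
  split_ifs <;> omega

/-- Every element of the set dominates a block element, and block elements all have the same length,
so nothing in the set lies strictly below one. -/
lemma mem_minimalNonpos_iff {t : BCType} {n r : ℕ} (hr : 1 ≤ r) {ω : V n} {c : ℝ}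
    (hω : HasScale n r ω c) {w : V n ≃ₗᵢ[ℝ] V n} :
    w ∈ minimalNonpos t n {(r : ℤ)} ω ↔ ∃ l, IsBlockElt n r w l := by
  have key : ∀ u ∈ minReps t n {(r : ℤ)}, IsNonpos t n (u ω) →
      ∃ u' l, IsBlockElt n r u' l ∧ BruhatLE t n u' u := by
    intro u hu hpos
    obtain ⟨σ, hσ, hmin⟩ := exists_isMin_of_mem_minReps hu
    exact exists_isBlockElt_bruhatLE t hr hσ hmin ((hσ.isNonpos_iff t hω).1 hpos)
  constructor
  · rintro ⟨⟨h1, h2⟩, h3⟩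
    obtain ⟨u, l, hu, hle⟩ := key w h1 h2
    have := hu.mem (t := t) hω
    exact ⟨l, h3 u this.1 this.2 hle ▸ hu⟩
  · rintro ⟨l, hl⟩
    refine ⟨hl.mem hω, fun u hu hpos hle => ?_⟩
    obtain ⟨u', l', hu', hle'⟩ := key u hu hpos
    have e := hl.length_eq_length t hr hu'
    rcases hle.eq_or_length_lt with h | h
    · exact h
    · rcases hle'.eq_or_length_lt with h' | h'
      · subst h'; omega
      · omega

lemma exists_isBlockElt (t : BCType) {n r : ℕ} (hr : 1 ≤ r) (hrn : r ≤ n) :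
    ∃ w l, IsBlockElt n r w l := by
  obtain ⟨σ, hσ, hw⟩ := exists_isMin hr hrn (f := -theta n r)
    (fun a => by simp only [Pi.neg_apply, theta_odd hr a])
    (fun a => by simp only [Pi.neg_apply, theta]; split_ifs <;> omega)
    (fun a ha => by
      simp only [Pi.neg_apply, theta]
      rcases lt_abs.1 ha with h | h <;> (split_ifs <;> omega))
    ((numOnes_neg (theta_odd hr)).trans (numOnes_theta hr))
  obtain ⟨w, h⟩ := exists_of_mem_signedPerms t hσ.1
  -- The element with weight `-theta n r` sends `ω_r` to `-ω_r ≤ 0`; descending from it reaches a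
  -- block element.
  obtain ⟨u, l, hu, -⟩ := exists_isBlockElt_bruhatLE t hr h hσ fun i h1 hn => by
    rw [hw, tailSum_neg, neg_nonpos]
    refine sum_nonneg fun k hk => ?_
    rw [mem_Icc] at hk
    unfold theta
    split_ifs <;> omega
  exact ⟨u, l, hu⟩

lemma Rep.hasOneLine {n : ℕ} {w : V n ≃ₗᵢ[ℝ] V n} {σ : Equiv.Perm ℤ} (h : Rep n w σ)
    {L : List ℤ} (hL : List.ofFn (fun j : Fin n => σ ((j : ℤ) + 1)) = L) : HasOneLine n w L := by
  subst hL
  refine ⟨fun x hx => ?_, ?_⟩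
  · obtain ⟨j, rfl⟩ := (List.mem_ofFn' _ _).1 hx
    exact ⟨Int.one_le_abs (map_ne_zero h.1 (by omega)),
      abs_map_le h.1 (abs_le.2 ⟨by omega, by omega⟩)⟩
  · rw [List.map_ofFn]
    congr 1
    ext1 j
    exact h.2 _

lemma coord_sum_blocks {n : ℕ} (l : List ℤ) {a : ℤ} (h1 : 1 ≤ a) (hn : a ≤ n) :
    coord ((l.map fun i => e n i - e n (i - 1)).sum) a = blkSum l a := by
  induction l with
  | nil => simp [coord]
  | cons i l ih =>
    rw [List.map_cons, List.sum_cons, coord_add, ih, coord_sub, coord_e h1 hn, coord_e h1 hn,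
      blkSum_cons, Pi.add_apply]
    simp only [blk]
    have e1 : a = -i ↔ -a = i := by omega
    have e2 : a = -(i - 1) ↔ -a = i - 1 := by omega
    simp only [e1, e2]
    push_cast
    ring

/-- The hypothesis `hc` says that the block sum has the number of ones required of a weight. -/
lemma exists_rep_blkSum (t : BCType) {n r : ℕ} (hr : 1 ≤ r) (hrn : r ≤ n) {l : List ℤ}
    (hl : IsBlk n l) (hc : n + 1 - r + (if 1 ∈ l then 1 else 0) = 2 * l.length) :
    ∃ w σ, Rep n w σ ∧ IsMin n r σ ∧ wt n r σ = blkSum l := by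
  obtain ⟨σ, hσ, hw⟩ := exists_isMin hr hrn (blkSum_odd l) (blkSum_range hl)
    (fun a ha => blkSum_of_large hl ha)
    (by rw [← numOnes_neg (blkSum_odd l)]; have := numOnes_neg_blkSum hl; omega)
  obtain ⟨w, h⟩ := exists_of_mem_signedPerms t hσ.1
  exact ⟨w, σ, h, hσ, hw⟩

lemma pairwise_complUp (n : ℕ) (S : Finset ℤ) : (complUp n S).Pairwise (· < ·) :=
  (sortedLT_sort _).pairwise

lemma mem_complUp {n : ℕ} {S : Finset ℤ} {a : ℤ} :
    a ∈ complUp n S ↔ (1 ≤ a ∧ a ≤ n) ∧ a ∉ S := by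
  simp [complUp]

lemma mem_negSeq {l : List ℤ} {a : ℤ} : a ∈ negSeq l ↔ -a ∈ l := by
  simp only [negSeq, List.mem_reverse, List.mem_map]
  constructor
  · rintro ⟨b, hb, rfl⟩; rwa [neg_neg]
  · intro h; exact ⟨-a, h, neg_neg a⟩

lemma mem_predSeq {l : List ℤ} {a : ℤ} : a ∈ predSeq l ↔ a + 1 ∈ l := by
  simp only [predSeq, List.mem_map]
  constructor
  · rintro ⟨b, hb, rfl⟩; rwa [sub_add_cancel]
  · intro h; exact ⟨a + 1, h, by ring⟩

lemma pairwise_negSeq {l : List ℤ} (h : l.Pairwise (· < ·)) : (negSeq l).Pairwise (· < ·) := by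
  rw [negSeq, List.pairwise_reverse, List.pairwise_map]
  exact h.imp fun h => by omega

lemma pairwise_predSeq {l : List ℤ} (h : l.Pairwise (· < ·)) : (predSeq l).Pairwise (· < ·) := by
  rw [predSeq, List.pairwise_map]
  exact h.imp fun h => by omega

lemma mem_J_iff {n m : ℕ} {a : ℤ} (ha : 1 ≤ a) {l : List ℤ} :
    l ∈ J m a n ↔ l.length = m ∧ IsBlk n l ∧ ∀ x ∈ l, a ≤ x := by
  have : Trans (fun x y : ℤ => 2 ≤ y - x) (fun x y : ℤ => 2 ≤ y - x)
    (fun x y : ℤ => 2 ≤ y - x) := ⟨fun h1 h2 => by omega⟩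
  simp only [J, Set.mem_ofPred_eq, List.isChain_iff_pairwise, IsBlk]
  constructor
  · rintro ⟨h1, h2, h3⟩
    exact ⟨h1, ⟨fun x hx => ⟨by have := h2 x hx; omega, (h2 x hx).2⟩,
      h3.imp fun h => by omega⟩, fun x hx => (h2 x hx).1⟩
  · rintro ⟨h1, ⟨h2, h3⟩, h4⟩
    exact ⟨h1, fun x hx => ⟨h4 x hx, (h2 x hx).2⟩, h3.imp fun h => by omega⟩

lemma IsBlockElt.eq {n r : ℕ} (hr : 1 ≤ r) (hrn : r ≤ n) {w w' : V n ≃ₗᵢ[ℝ] V n} {l : List ℤ}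
    (h : IsBlockElt n r w l) (h' : IsBlockElt n r w' l) : w = w' := by
  obtain ⟨hl, σ, hw, hσ, hwt⟩ := h
  obtain ⟨-, τ, hw', hτ, hwt'⟩ := h'
  rw [hσ.eq_of_wt_eq hr hrn hτ (hwt.trans hwt'.symm)] at hw
  exact hw.eq hw'

/-- The one-line notation of an element whose weight is minus a sum of blocks. -/
lemma IsBlockElt.hasOneLine {n r : ℕ} (hr : 1 ≤ r) (hrn : r ≤ n) {w : V n ≃ₗᵢ[ℝ] V n}
    {l : List ℤ} (h : IsBlockElt n r w l) {A B : List ℤ} (hA : A.Pairwise (· < ·))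
    (hB : B.Pairwise (· < ·)) (hA' : ∀ p, p ∈ A ↔ (1 ≤ p ∧ p ≤ n) ∧ p ∉ l ∧ p + 1 ∉ l)
    (hB' : ∀ p, p ∈ B ↔ -p ∈ l ∨ (1 ≤ p ∧ p + 1 ∈ l)) : HasOneLine n w (A ++ B) := by
  obtain ⟨hl, σ, hw, hσ, hwt⟩ := h
  refine hw.hasOneLine (hσ.oneLine hr hrn hA hB (fun p => ?_) (fun p => ?_))
  · rw [hA', hwt, and_assoc, Pi.neg_apply, neg_eq_zero]
    exact and_congr_right fun h => and_congr_right fun _ => (blkSum_eq_zero hl h).symm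
  · rw [hB', hwt, Pi.neg_apply, blkSum_eq_neg_one hl]

/-- The properties of the elements `v` and `u v` attached to a list of blocks, where `u` is the
product of the corresponding simple reflections, except for their one-line notations. -/
lemma exists_block_elements (t : BCType) {n r : ℕ} (hr : 1 ≤ r) (hrn : r ≤ n) {ω : V n}
    (hω : HasScale n r ω 1) {l : List ℤ} (hl : IsBlk n l)
    (hc : n + 1 - r + (if 1 ∈ l then 1 else 0) = 2 * l.length) :
    ∃ v : V n ≃ₗᵢ[ℝ] V n,
      (v ∈ minReps t n {(r : ℤ)} ∧ v ω = (l.map fun i => e n i - e n (i - 1)).sum ∧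
        ∀ u ∈ minReps t n {(r : ℤ)}, u ω = (l.map fun i => e n i - e n (i - 1)).sum → u = v) ∧
      (wordProd t n l * v) ω = -(v ω) ∧ IsBlockElt n r (wordProd t n l * v) l ∧
      (∀ A B : List ℤ, A.Pairwise (· < ·) → B.Pairwise (· < ·) →
        (∀ p, p ∈ A ↔ (1 ≤ p ∧ p ≤ n) ∧ p ∉ l ∧ p + 1 ∉ l) →
        (∀ p, p ∈ B ↔ p ∈ l ∨ (p ≤ -1 ∧ 1 - p ∈ l)) → HasOneLine n v (A ++ B)) := by
  obtain ⟨v, σ, hv, hσ, hwt⟩ := exists_rep_blkSum t hr hrn hl hc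
  obtain ⟨hσ', hwt'⟩ := hσ.wordPerm_mul hr hl hwt
  have hw : Rep n (wordProd t n l * v) (wordPerm l * σ) := (rep_wordProd t hl.1).mul hv
  have hvω : v ω = (l.map fun i => e n i - e n (i - 1)).sum := eq_of_coord_eq fun a h1 hn => by
    rw [coord_sum_blocks l h1 hn, hv.coord_weight hω, hwt, one_mul]
  refine ⟨v, ⟨(hv.mem_minReps_iff t).2 hσ, hvω, fun u hu huω => ?_⟩, ?_,
    ⟨hl, _, hw, hσ', hwt'⟩, ?_⟩
  · obtain ⟨τ, hτ, hmin⟩ := exists_isMin_of_mem_minReps hu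
    exact hτ.eq_of_apply_eq hr hrn hω hv hmin hσ (huω.trans hvω.symm)
  · refine eq_of_coord_eq fun a h1 hn => ?_
    rw [coord_neg_vec, hw.coord_weight hω, hv.coord_weight hω, hwt, hwt']
    simp
  · intro A B hA hB hA' hB'
    refine hv.hasOneLine (hσ.oneLine hr hrn hA hB (fun p => ?_) (fun p => ?_))
    · rw [hA', hwt, and_assoc]
      exact and_congr_right fun h => and_congr_right fun _ => (blkSum_eq_zero hl h).symm
    · rw [hB', hwt, blkSum_eq_one hl]

/-- If the blocks are determined, there is a single minimal element. -/
lemma exists_minimalNonpos_eq_singleton (t : BCType) {n r : ℕ} (hr : 1 ≤ r) (hrn : r ≤ n)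
    {ω : V n} {c : ℝ} (hω : HasScale n r ω c) {l A B : List ℤ}
    (huniq : ∀ (w : V n ≃ₗᵢ[ℝ] V n) (l' : List ℤ), IsBlockElt n r w l' → l' = l)
    (hA : A.Pairwise (· < ·)) (hB : B.Pairwise (· < ·))
    (hA' : ∀ p, p ∈ A ↔ (1 ≤ p ∧ p ≤ n) ∧ p ∉ l ∧ p + 1 ∉ l)
    (hB' : ∀ p, p ∈ B ↔ -p ∈ l ∨ (1 ≤ p ∧ p + 1 ∈ l)) :
    ∃ w, HasOneLine n w (A ++ B) ∧ minimalNonpos t n {(r : ℤ)} ω = {w} := by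
  obtain ⟨w, l', hw⟩ := exists_isBlockElt t hr hrn
  obtain rfl := huniq w l' hw
  refine ⟨w, hw.hasOneLine hr hrn hA hB hA' hB', ?_⟩
  ext u
  rw [mem_minimalNonpos_iff hr hω, Set.mem_singleton_iff]
  constructor
  · rintro ⟨l, hu⟩
    obtain rfl := huniq u l hu
    exact hu.eq hr hrn hw
  · rintro rfl
    exact ⟨_, hw⟩

end

end BCType

namespace BCType

open Finset SignedPerm

noncomputable section

/-! ### The block lists in the four cases. -/

lemma map_simpleRoot_eq (t : BCType) (n : ℕ) {l : List ℤ} (hl : ∀ x ∈ l, (2 : ℤ) ≤ x) :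
    l.map (simpleRoot t n) = l.map fun i => e n i - e n (i - 1) :=
  List.map_congr_left fun i hi => by
    rw [simpleRoot, if_neg (by have := hl i hi; omega)]

lemma one_div_smul_simpleRoot_one (t : BCType) (n : ℕ) :
    (1 / t.specialLength) • simpleRoot t n 1 = e n 1 - e n (1 - 1) := by
  rw [simpleRoot, if_pos rfl, smul_smul, one_div_mul_cancel (specialLength_pos t).ne', one_smul,
    sub_self, e_zero, sub_zero]

/-- For `r = 1` the weight vanishes at no index in `[1, n]`, so the blocks cover all of them. -/
lemma IsBlockElt.mem_or_succ_mem {n : ℕ} {w : V n ≃ₗᵢ[ℝ] V n} {l : List ℤ}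
    (h : IsBlockElt n 1 w l) {p : ℤ} (h1 : 1 ≤ p) (hn : p ≤ n) : p ∈ l ∨ p + 1 ∈ l := by
  obtain ⟨hl, σ, hw, hσ, hwt⟩ := h
  by_contra! h2
  have h3 := (blkSum_eq_zero hl h1).2 h2
  have h4 : wt n 1 σ p = 0 := by rw [hwt, Pi.neg_apply, h3, neg_zero]
  have h5 := map_ne_zero (inv_mem hσ.1) (show p ≠ 0 by omega)
  have h6 := abs_le.1 (abs_map_le (inv_mem hσ.1) (a := p) (abs_le.2 ⟨by omega, hn⟩))
  unfold wt theta at h4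
  push_cast at h4
  split_ifs at h4 <;> omega

/-- Index `n` can only be covered by the block at `n`; downwards from there, covering and
disjointness make membership alternate. -/
lemma IsBlockElt.mem_iff_of_one {n : ℕ} {w : V n ≃ₗᵢ[ℝ] V n} {l : List ℤ}
    (h : IsBlockElt n 1 w l) (p : ℤ) : p ∈ l ↔ 1 ≤ p ∧ p ≤ n ∧ (n - p) % 2 = 0 := by
  have key : ∀ d : ℕ, d < n → ((n : ℤ) - d ∈ l ↔ d % 2 = 0) := by
    intro d
    induction d with
    | zero =>
      intro hd
      have h1 := h.mem_or_succ_mem (p := n) (by omega) le_rfl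
      have h2 : (n : ℤ) + 1 ∉ l := fun h2 => by have := h.1.1 _ h2; omega
      simpa using h1.resolve_right h2
    | succ d ih =>
      intro hd
      have h1 := h.mem_or_succ_mem (p := n - (d + 1 : ℕ)) (by omega) (by omega)
      have h2 := h.1.succ_notMem (a := n - (d + 1 : ℕ))
      rw [show (n : ℤ) - (d + 1 : ℕ) + 1 = n - d by push_cast; ring, ih (by omega)] at h1 h2
      constructor
      · intro h3
        have := h2 h3
        omega
      · intro h3
        exact h1.resolve_right (by omega)
  constructor
  · intro hp
    have h1 := h.1.1 p hp
    have h2 := key (n - p).toNat (by omega)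
    rw [show (n : ℤ) - ((n - p).toNat : ℤ) = p by omega] at h2
    have := h2.1 hp
    omega
  · rintro ⟨h1, h2, h3⟩
    have h4 := key (n - p).toNat (by omega)
    rw [show (n : ℤ) - ((n - p).toNat : ℤ) = p by omega] at h4
    exact h4.2 (by omega)

lemma minimalNonpos_one_even (t : BCType) {n k : ℕ} (hk : n = 2 * k) (hn : 1 ≤ n) {ω : V n} {c : ℝ}
    (hω : HasScale n 1 ω c) :
    ∃ w, HasOneLine n w
        ((List.range k).map (fun j : ℕ => -((n : ℤ) - 2 * j)) ++
          (List.range k).map (fun j : ℕ => 2 * (j : ℤ) + 1)) ∧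
      minimalNonpos t n {((1 : ℕ) : ℤ)} ω = {w} := by
  have hmem : ∀ p : ℤ, p ∈ (List.range k).map (fun j : ℕ => 2 * (j : ℤ) + 2) ↔
      1 ≤ p ∧ p ≤ n ∧ (n - p) % 2 = 0 := by
    intro p
    simp only [List.mem_map, List.mem_range]
    constructor
    · rintro ⟨j, hj, rfl⟩; omega
    · intro h; exact ⟨(p / 2 - 1).toNat, by omega, by omega⟩
  refine exists_minimalNonpos_eq_singleton t le_rfl hn hω (A := [])
    (B := (List.range k).map (fun j : ℕ => -((n : ℤ) - 2 * j)) ++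
      (List.range k).map (fun j : ℕ => 2 * (j : ℤ) + 1))
    (l := (List.range k).map fun j : ℕ => 2 * (j : ℤ) + 2) ?_ List.Pairwise.nil ?_ ?_ ?_
  · intro w l' h
    refine eq_of_pairwise_lt (h.1.2.imp fun h => by omega) ?_ fun p => ?_
    · rw [List.pairwise_map]
      exact List.pairwise_lt_range.imp fun h => by omega
    · rw [h.mem_iff_of_one, hmem]
  · rw [List.pairwise_append, List.pairwise_map, List.pairwise_map]
    refine ⟨List.pairwise_lt_range.imp fun h => by omega,
      List.pairwise_lt_range.imp fun h => by omega, ?_⟩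
    simp only [List.mem_map, List.mem_range]
    rintro _ ⟨a, ha, rfl⟩ _ ⟨b, hb, rfl⟩
    omega
  · intro p
    rw [hmem, hmem]
    simp only [List.not_mem_nil, false_iff]
    omega
  · intro p
    rw [hmem, hmem]
    simp only [List.mem_append, List.mem_map, List.mem_range]
    constructor
    · rintro (⟨a, ha, rfl⟩ | ⟨a, ha, rfl⟩)
      · left; omega
      · right; omega
    · rintro (h | h)
      · exact Or.inl ⟨((n + p) / 2).toNat, by omega, by omega⟩
      · exact Or.inr ⟨((p - 1) / 2).toNat, by omega, by omega⟩

/-- The blocks sit at `1, 3, …, n`. The one at 1 contributes only the entry `-1`, whence one more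
negative entry than positive ones. -/
lemma minimalNonpos_one_odd (t : BCType) {n k : ℕ} (hk : n = 2 * k + 1) {ω : V n} {c : ℝ}
    (hω : HasScale n 1 ω c) :
    ∃ w, HasOneLine n w
        ((List.range (k + 1)).map (fun j : ℕ => -((n : ℤ) - 2 * j)) ++
          (List.range k).map (fun j : ℕ => 2 * (j : ℤ) + 2)) ∧
      minimalNonpos t n {((1 : ℕ) : ℤ)} ω = {w} := by
  have hmem : ∀ p : ℤ, p ∈ (List.range (k + 1)).map (fun j : ℕ => 2 * (j : ℤ) + 1) ↔
      1 ≤ p ∧ p ≤ n ∧ (n - p) % 2 = 0 := by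
    intro p
    simp only [List.mem_map, List.mem_range]
    constructor
    · rintro ⟨j, hj, rfl⟩; omega
    · intro h; exact ⟨((p - 1) / 2).toNat, by omega, by omega⟩
  refine exists_minimalNonpos_eq_singleton t le_rfl (by omega) hω (A := [])
    (B := (List.range (k + 1)).map (fun j : ℕ => -((n : ℤ) - 2 * j)) ++
      (List.range k).map (fun j : ℕ => 2 * (j : ℤ) + 2))
    (l := (List.range (k + 1)).map fun j : ℕ => 2 * (j : ℤ) + 1) ?_ List.Pairwise.nil ?_ ?_ ?_
  · intro w l' h
    refine eq_of_pairwise_lt (h.1.2.imp fun h => by omega) ?_ fun p => ?_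
    · rw [List.pairwise_map]
      exact List.pairwise_lt_range.imp fun h => by omega
    · rw [h.mem_iff_of_one, hmem]
  · rw [List.pairwise_append, List.pairwise_map, List.pairwise_map]
    refine ⟨List.pairwise_lt_range.imp fun h => by omega,
      List.pairwise_lt_range.imp fun h => by omega, ?_⟩
    simp only [List.mem_map, List.mem_range]
    rintro _ ⟨a, ha, rfl⟩ _ ⟨b, hb, rfl⟩
    omega
  · intro p
    rw [hmem, hmem]
    simp only [List.not_mem_nil, false_iff]
    omega
  · intro p
    rw [hmem, hmem]
    simp only [List.mem_append, List.mem_map, List.mem_range]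
    constructor
    · rintro (⟨a, ha, rfl⟩ | ⟨a, ha, rfl⟩)
      · left; omega
      · right; omega
    · rintro (h | h)
      · exact Or.inl ⟨((n + p) / 2).toNat, by omega, by omega⟩
      · exact Or.inr ⟨((p - 2) / 2).toNat, by omega, by omega⟩

lemma minimalNonpos_last (t : BCType) {n : ℕ} (hn : 1 ≤ n) {ω : V n} {c : ℝ}
    (hω : HasScale n n ω c) :
    ∃ w, HasOneLine n w ((List.range (n - 1)).map (fun j : ℕ => (j : ℤ) + 2) ++ [-1]) ∧
      minimalNonpos t n {(n : ℤ)} ω = {w} := by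
  refine exists_minimalNonpos_eq_singleton t hn le_rfl hω (l := [1]) ?_ ?_
    (List.pairwise_singleton _ _) ?_ ?_
  · intro w l h
    have h1 := h.two_mul_length hn
    -- For `r = n` there is a single one, an odd number, so a block at 1 is present and it is the
    -- only block.
    have h2 : 1 ∈ l := by
      by_contra h2
      rw [if_neg h2] at h1
      omega
    rw [if_pos h2] at h1
    obtain ⟨a, rfl⟩ := List.length_eq_one_iff.1 (show l.length = 1 by omega)
    rw [List.mem_singleton.1 h2]
  · rw [List.pairwise_map]
    exact List.pairwise_lt_range.imp fun h => by omega
  · intro p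
    simp only [List.mem_map, List.mem_range, List.mem_singleton]
    constructor
    · rintro ⟨j, hj, rfl⟩; omega
    · intro h; exact ⟨(p - 2).toNat, by omega, by omega⟩
  · intro p
    simp only [List.mem_singleton]
    omega

/-- The minimal elements are those attached to the lists of blocks of the right length. -/
lemma minimalNonpos_eq_image {t : BCType} {n r : ℕ} (hr : 1 ≤ r) (hrn : r ≤ n) {ω : V n} {c : ℝ}
    (hω : HasScale n r ω c) {ι : Type*} {S : Set ι} (L : ι → List ℤ)
    (hL : ∀ l, IsBlk n l → n + 1 - r + (if 1 ∈ l then 1 else 0) = 2 * l.length → ∃ i ∈ S, L i = l)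
    {w : ι → (V n ≃ₗᵢ[ℝ] V n)} (hw : ∀ i ∈ S, IsBlockElt n r (w i) (L i)) :
    minimalNonpos t n {(r : ℤ)} ω = w '' S := by
  ext u
  rw [mem_minimalNonpos_iff hr hω]
  constructor
  · rintro ⟨l, hu⟩
    obtain ⟨i, hi, rfl⟩ := hL l hu.1 (hu.two_mul_length hr)
    exact ⟨i, hi, (hw i hi).eq hr hrn hu⟩
  · rintro ⟨i, hi, rfl⟩
    exact ⟨_, hw i hi⟩

lemma minimalNonpos_middle_even (t : BCType) {n r m : ℕ} (hr : 2 ≤ r) (hrn : r + 1 ≤ n)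
    (hm : n + 1 = r + 2 * m) {ω : V n} (hω : HasScale n r ω 1) :
    ∃ v : List ℤ → (V n ≃ₗᵢ[ℝ] V n),
      (∀ i ∈ J m 2 n,
        (v i ∈ minReps t n {(r : ℤ)} ∧
          v i ω = (i.map (simpleRoot t n)).sum ∧
          ∀ u ∈ minReps t n {(r : ℤ)}, u ω = (i.map (simpleRoot t n)).sum → u = v i) ∧
        HasOneLine n (v i)
          (complUp n (i.toFinset ∪ (predSeq i).toFinset) ++ negSeq (predSeq i) ++ i) ∧
        HasOneLine n (wordProd t n i * v i)
          (complUp n (i.toFinset ∪ (predSeq i).toFinset) ++ negSeq i ++ predSeq i) ∧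
        (wordProd t n i * v i) ω = -(v i ω)) ∧
      minimalNonpos t n {(r : ℤ)} ω = (fun i => wordProd t n i * v i) '' J m 2 n := by
  have H : ∀ i ∈ J m 2 n, IsBlk n i ∧ (∀ x ∈ i, (2 : ℤ) ≤ x) ∧
      n + 1 - r + (if 1 ∈ i then 1 else 0) = 2 * i.length := by
    intro i hi
    obtain ⟨h1, h2, h3⟩ := (mem_J_iff (by norm_num)).1 hi
    refine ⟨h2, h3, ?_⟩
    rw [if_neg fun h => by have := h3 1 h; omega]
    omega
  have Hv := fun (i : List ℤ) (hi : i ∈ J m 2 n) =>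
    exists_block_elements t (by omega) (by omega) hω (H i hi).1 (H i hi).2.2
  -- Outside `J m 2 n` the values of `v` are arbitrary and play no role.
  choose! v hv using Hv
  refine ⟨v, fun i hi => ?_, ?_⟩
  · obtain ⟨h1, h2, h3, h4⟩ := hv i hi
    obtain ⟨hblk, hge, -⟩ := H i hi
    have hlt : i.Pairwise (· < ·) := hblk.2.imp fun h => by omega
    rw [map_simpleRoot_eq t n hge]
    have hA : ∀ p, p ∈ complUp n (i.toFinset ∪ (predSeq i).toFinset) ↔
        (1 ≤ p ∧ p ≤ n) ∧ p ∉ i ∧ p + 1 ∉ i := fun p => by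
      rw [mem_complUp, mem_union, List.mem_toFinset, List.mem_toFinset, mem_predSeq, not_or]
    refine ⟨h1, ?_, ?_, h2⟩
    · rw [List.append_assoc]
      refine h4 _ _ (pairwise_complUp _ _) ?_ hA fun p => ?_
      · rw [List.pairwise_append]
        refine ⟨pairwise_negSeq (pairwise_predSeq hlt), hlt, fun a ha b hb => ?_⟩
        rw [mem_negSeq, mem_predSeq] at ha
        have := hge _ ha
        have := hge _ hb
        omega
      · rw [List.mem_append, mem_negSeq, mem_predSeq, or_comm, show -p + 1 = 1 - p by ring]
        refine or_congr_right ⟨fun h => ⟨?_, h⟩, And.right⟩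
        have := hge _ h
        omega
    · rw [List.append_assoc]
      refine h3.hasOneLine (by omega) (by omega) (pairwise_complUp _ _) ?_ hA fun p => ?_
      · rw [List.pairwise_append]
        refine ⟨pairwise_negSeq hlt, pairwise_predSeq hlt, fun a ha b hb => ?_⟩
        rw [mem_negSeq] at ha
        rw [mem_predSeq] at hb
        have := hge _ ha
        have := hge _ hb
        omega
      · rw [List.mem_append, mem_negSeq, mem_predSeq]
        refine or_congr_right ⟨fun h => ⟨?_, h⟩, And.right⟩
        have := hge _ h
        omega
  · refine minimalNonpos_eq_image (by omega) (by omega) hω id (fun l hl hc => ⟨l, ?_, rfl⟩)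
      fun i hi => (hv i hi).2.2.1
    -- Here `n + 1 - r` is even, so a block at 1 would violate the count of ones.
    have h1 : (1 : ℤ) ∉ l := fun h => by rw [if_pos h] at hc; omega
    rw [if_neg h1] at hc
    refine (mem_J_iff (by norm_num)).2 ⟨by omega, hl, fun x hx => ?_⟩
    have := hl.1 x hx
    rcases eq_or_ne x 1 with rfl | h2
    · exact absurd hx h1
    · omega

lemma minimalNonpos_middle_odd (t : BCType) {n r m : ℕ} (hr : 2 ≤ r) (hrn : r + 1 ≤ n)
    (hm : n + 1 = r + (2 * m + 1)) {ω : V n} (hω : HasScale n r ω 1) :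
    ∃ v : List ℤ → (V n ≃ₗᵢ[ℝ] V n),
      (∀ i ∈ J m 3 n,
        (v i ∈ minReps t n {(r : ℤ)} ∧
          v i ω = (1 / t.specialLength) • simpleRoot t n 1 + (i.map (simpleRoot t n)).sum ∧
          ∀ u ∈ minReps t n {(r : ℤ)},
            u ω = (1 / t.specialLength) • simpleRoot t n 1 + (i.map (simpleRoot t n)).sum →
              u = v i) ∧
        HasOneLine n (v i)
          (complUp n ({1} ∪ i.toFinset ∪ (predSeq i).toFinset) ++
            negSeq (predSeq i) ++ [1] ++ i) ∧
        HasOneLine n (s t n 1 * wordProd t n i * v i)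
          (complUp n ({1} ∪ i.toFinset ∪ (predSeq i).toFinset) ++
            negSeq i ++ [-1] ++ predSeq i) ∧
        (s t n 1 * wordProd t n i * v i) ω = -(v i ω)) ∧
      minimalNonpos t n {(r : ℤ)} ω =
        (fun i => s t n 1 * wordProd t n i * v i) '' J m 3 n := by
  -- The block list attached to `i` is `1 :: i`; the gap condition after 1 is why `i` starts at 3 or
  -- later.
  have hcons : ∀ i : List ℤ, s t n 1 * wordProd t n i = wordProd t n (1 :: i) := fun i => by
    simp [wordProd]
  simp only [hcons]
  have H : ∀ i ∈ J m 3 n, IsBlk n (1 :: i) ∧ (∀ x ∈ i, (3 : ℤ) ≤ x) ∧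
      n + 1 - r + (if 1 ∈ 1 :: i then 1 else 0) = 2 * (1 :: i).length := by
    intro i hi
    obtain ⟨h1, h2, h3⟩ := (mem_J_iff (by norm_num)).1 hi
    refine ⟨⟨?_, List.pairwise_cons.2 ⟨fun x hx => h3 x hx, h2.2⟩⟩, h3, ?_⟩
    · rintro x hx
      rcases List.mem_cons.1 hx with rfl | hx
      · omega
      · exact h2.1 x hx
    · rw [if_pos (by simp), List.length_cons]
      omega
  have Hv := fun (i : List ℤ) (hi : i ∈ J m 3 n) =>
    exists_block_elements t (by omega) (by omega) hω (H i hi).1 (H i hi).2.2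
  choose! v hv using Hv
  refine ⟨v, fun i hi => ?_, ?_⟩
  · obtain ⟨h1, h2, h3, h4⟩ := hv i hi
    obtain ⟨hblk, hge, -⟩ := H i hi
    have hlt : i.Pairwise (· < ·) := hblk.tail.2.imp fun h => by omega
    rw [map_simpleRoot_eq t n fun x hx => by have := hge x hx; omega,
      one_div_smul_simpleRoot_one]
    have hA : ∀ p, p ∈ complUp n ({1} ∪ i.toFinset ∪ (predSeq i).toFinset) ↔
        (1 ≤ p ∧ p ≤ n) ∧ p ∉ 1 :: i ∧ p + 1 ∉ 1 :: i := fun p => by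
      rw [mem_complUp, mem_union, mem_union, List.mem_toFinset, List.mem_toFinset, mem_predSeq,
        not_or, mem_singleton, List.mem_cons, List.mem_cons]
      refine and_congr_right fun h => and_congr_right fun _ => ?_
      have : p + 1 ≠ 1 := by omega
      simp [this]
    refine ⟨h1, ?_, ?_, h2⟩
    · rw [List.append_assoc, List.append_assoc]
      refine h4 _ _ (pairwise_complUp _ _) ?_ hA fun p => ?_
      · rw [List.singleton_append, List.pairwise_append, List.pairwise_cons]
        refine ⟨pairwise_negSeq (pairwise_predSeq hlt),
          ⟨fun x hx => by have := hge x hx; omega, hlt⟩, fun a ha b hb => ?_⟩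
        rw [mem_negSeq, mem_predSeq] at ha
        have := hge _ ha
        rcases List.mem_cons.1 hb with rfl | hb
        · omega
        · have := hge _ hb
          omega
      · rw [List.singleton_append, List.mem_append, mem_negSeq, mem_predSeq, or_comm,
          show -p + 1 = 1 - p by ring]
        refine or_congr_right ⟨fun h => ⟨?_, List.mem_cons_of_mem _ h⟩, fun h => ?_⟩
        · have := hge _ h
          omega
        · exact (List.mem_cons.1 h.2).resolve_left (by omega)
    · rw [List.append_assoc, List.append_assoc]
      refine h3.hasOneLine (by omega) (by omega) (pairwise_complUp _ _) ?_ hA fun p => ?_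
      · rw [List.singleton_append, List.pairwise_append, List.pairwise_cons]
        refine ⟨pairwise_negSeq hlt, ⟨fun x hx => ?_, pairwise_predSeq hlt⟩, fun a ha b hb => ?_⟩
        · have := hge _ (mem_predSeq.1 hx)
          omega
        · rw [mem_negSeq] at ha
          have := hge _ ha
          rcases List.mem_cons.1 hb with rfl | hb
          · omega
          · have := hge _ (mem_predSeq.1 hb)
            omega
      · rw [List.singleton_append, List.mem_append, mem_negSeq, List.mem_cons, mem_predSeq,
          List.mem_cons, List.mem_cons]
        constructor
        · rintro (h | rfl | h)
          · exact Or.inl (Or.inr h)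
          · exact Or.inl (Or.inl rfl)
          · have := hge _ h
            exact Or.inr ⟨by omega, Or.inr h⟩
        · rintro ((h | h) | ⟨h, h' | h'⟩)
          · exact Or.inr (Or.inl (by omega))
          · exact Or.inl h
          · omega
          · exact Or.inr (Or.inr h')
  · refine minimalNonpos_eq_image (by omega) (by omega) hω (fun i => 1 :: i) (fun l hl hc => ?_)
      fun i hi => (hv i hi).2.2.1
    -- Here `n + 1 - r` is odd, which forces a block at 1.
    have h1 : (1 : ℤ) ∈ l := by
      by_contra h
      rw [if_neg h] at hc
      omega
    rw [if_pos h1] at hc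
    cases l with
    | nil => simp at h1
    | cons a l =>
      have h2 := hl.head
      obtain rfl : 1 = a := by
        rcases List.mem_cons.1 h1 with h | h
        · exact h
        · have := h2.2.2 1 h
          omega
      refine ⟨l, (mem_J_iff (by norm_num)).2 ⟨?_, hl.tail, h2.2.2⟩, rfl⟩
      rw [List.length_cons] at hc
      omega

end

end BCType

theorem proposition4p3 (t : BCType) (n r : ℕ) (hr : 1 ≤ r) (hrn : r ≤ n)
    (ω : BCType.V n) (hω : BCType.IsFundamentalWeight t n r ω) :
    -- (i), `n` even
    (∀ k : ℕ, r = 1 → n = 2 * k →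
      ∃ w, BCType.HasOneLine n w
          ((List.range k).map (fun j : ℕ => -((n : ℤ) - 2 * j)) ++
            (List.range k).map (fun j : ℕ => 2 * (j : ℤ) + 1)) ∧
        BCType.minimalNonpos t n {(r : ℤ)} ω = {w}) ∧
    -- (i), `n` odd
    (∀ k : ℕ, r = 1 → n = 2 * k + 1 →
      ∃ w, BCType.HasOneLine n w
          ((List.range (k + 1)).map (fun j : ℕ => -((n : ℤ) - 2 * j)) ++
            (List.range k).map (fun j : ℕ => 2 * (j : ℤ) + 2)) ∧
        BCType.minimalNonpos t n {(r : ℤ)} ω = {w}) ∧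
    -- (ii)
    (∀ m : ℕ, 2 ≤ r → r + 1 ≤ n → n + 1 = r + 2 * m →
      ∃ v : List ℤ → (BCType.V n ≃ₗᵢ[ℝ] BCType.V n),
        (∀ i ∈ BCType.J m 2 n,
          (v i ∈ BCType.minReps t n {(r : ℤ)} ∧
            v i ω = (i.map (BCType.simpleRoot t n)).sum ∧
            ∀ u ∈ BCType.minReps t n {(r : ℤ)},
              u ω = (i.map (BCType.simpleRoot t n)).sum → u = v i) ∧
          BCType.HasOneLine n (v i)
            (BCType.complUp n (i.toFinset ∪ (BCType.predSeq i).toFinset) ++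
              BCType.negSeq (BCType.predSeq i) ++ i) ∧
          BCType.HasOneLine n (BCType.wordProd t n i * v i)
            (BCType.complUp n (i.toFinset ∪ (BCType.predSeq i).toFinset) ++
              BCType.negSeq i ++ BCType.predSeq i) ∧
          (BCType.wordProd t n i * v i) ω = -(v i ω)) ∧
        BCType.minimalNonpos t n {(r : ℤ)} ω =
          (fun i => BCType.wordProd t n i * v i) '' BCType.J m 2 n) ∧
    -- (iii); the coefficient of `α_1` is `1` in type `B_n` and `1/2` in type `C_n`
    (∀ m : ℕ, 2 ≤ r → r + 1 ≤ n → n + 1 = r + (2 * m + 1) →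
      ∃ v : List ℤ → (BCType.V n ≃ₗᵢ[ℝ] BCType.V n),
        (∀ i ∈ BCType.J m 3 n,
          (v i ∈ BCType.minReps t n {(r : ℤ)} ∧
            v i ω = (1 / t.specialLength) • BCType.simpleRoot t n 1 +
              (i.map (BCType.simpleRoot t n)).sum ∧
            ∀ u ∈ BCType.minReps t n {(r : ℤ)},
              u ω = (1 / t.specialLength) • BCType.simpleRoot t n 1 +
                (i.map (BCType.simpleRoot t n)).sum → u = v i) ∧
          BCType.HasOneLine n (v i)
            (BCType.complUp n ({1} ∪ i.toFinset ∪ (BCType.predSeq i).toFinset) ++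
              BCType.negSeq (BCType.predSeq i) ++ [1] ++ i) ∧
          BCType.HasOneLine n (BCType.s t n 1 * BCType.wordProd t n i * v i)
            (BCType.complUp n ({1} ∪ i.toFinset ∪ (BCType.predSeq i).toFinset) ++
              BCType.negSeq i ++ [-1] ++ BCType.predSeq i) ∧
          (BCType.s t n 1 * BCType.wordProd t n i * v i) ω = -(v i ω)) ∧
        BCType.minimalNonpos t n {(r : ℤ)} ω =
          (fun i => BCType.s t n 1 * BCType.wordProd t n i * v i) '' BCType.J m 3 n) ∧
    -- (iv)
    (r = n →
      ∃ w, BCType.HasOneLine n w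
          ((List.range (n - 1)).map (fun j : ℕ => (j : ℤ) + 2) ++ [-1]) ∧
        BCType.minimalNonpos t n {(r : ℤ)} ω = {w})
 := by
  obtain ⟨c, hc, hc1, hco⟩ := BCType.exists_coord_fundamentalWeight hr hrn hω
  have hs : BCType.HasScale n r ω c := ⟨hc, hco⟩
  refine ⟨?_, ?_, ?_, ?_, ?_⟩
  · rintro k rfl hk
    exact BCType.minimalNonpos_one_even t hk hrn hs
  · rintro k rfl hk
    exact BCType.minimalNonpos_one_odd t hk hs
  · intro m h2 h3 hm
    -- For `r ≥ 2` the scale is 1, so `v(ω_r)` is the block sum itself and not just a multiple of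
    -- it.
    exact BCType.minimalNonpos_middle_even t h2 h3 hm (hc1 h2 ▸ hs)
  · intro m h2 h3 hm
    exact BCType.minimalNonpos_middle_odd t h2 h3 hm (hc1 h2 ▸ hs)
  · rintro rfl
    exact BCType.minimalNonpos_last t hr hs
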